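/- Let $\mathcal V$ be a variety (an equationally definable class of non-empty algebras of a fixed, arbitrary finitary algebraic language) with $\vec 0\,\&\,\vec 1$: there are an integer $l\ge 0$ and closed terms $\vec 0=(0_1,\dots,0_l)$, $\vec 1=(1_1,\dots,1_l)$ such that $\mathcal V\models \vec 0=\vec 1\rightarrow x=y$. Congruences $\theta,\theta^*$ of $A$ are called complementary factor congruences, $\theta\diamond\theta^*=\Delta$, if they are the kernels of the two canonical projections of a representation of $A$ as a direct product of two algebras. $\mathcal V$ has the Left Determining Property if for all $A\in\mathcal V$, $\vec e\in A^l$ and congruences $\phi,\varphi^*,\theta,\theta^*$ of $A$ with $\phi\diamond\varphi^*=\Delta$, $\theta\diamond\theta^*=\Delta$, $\vec 0\,\theta\,\vec e\,\theta^*\,\vec 1$ and $\vec 0\,\phi\,\vec e\,\varphi^*\,\vec 1$ (componentwise), one has $\theta=\phi$. Given $n\ge 0$ and $(2i+l)$-ary terms $s_i,t_i$ ($1\le i\le n$), let $\vec X=(x,y,\vec z,x_1,y_1,\dots,x_n,y_n)$ be variables, with $\vec z=(z_1,\dots,z_l)$, and define tuples of terms $(x',y',\vec z\,',x'_1,y'_1,\dots,x'_n,y'_n)$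 in these variables by the following recursions on $j$, where $r_j(\cdots)$ abbreviates $r_j(x',y',\vec z\,',x'_1,y'_1,\dots,x'_{j-1},y'_{j-1})$: - $\sigma(\vec X)$: $x'=x$, $y'=x$, $\vec z\,'=\vec 0$, $x'_j=s_j(\cdots)$, $y'_j=y_j$; - $\sigma^*(\vec X)$: $x'=x$, $y'=y$, $\vec z\,'=\vec 1$, $x'_j=t_j(\cdots)$, $y'_j=y_j$; - $\rho(\vec X)$: $x'=x$, $y'=y$, $\vec z\,'=\vec 0$, $x'_j=x_j$, $y'_j=s_j(\cdots)$; - $\rho^*(\vec X)$: $x'=x$, $y'=y$, $\vec z\,'=\vec 1$, $x'_j=x_j$, $y'_j=t_j(\cdots)$. For a substitution $\tau$, a word $\alpha$ and letters $p\le q$, let $C(\tau,\alpha,p,q)$ be the set of identities $$L_\alpha(\tau(\vec X))\approx L_{\alpha p}(\tau(\vec X)),\qquad R_{\alpha j}(\tau(\vec X))\approx L_{\alpha(j+1)}(\tau(\vec X))\ \ (p\le j\le q-1),\qquad R_{\alpha q}(\tau(\vec X))\approx R_\alpha(\tau(\vec X)).$$ **Theorem.** $\mathcal V$ has the Left Determining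 Property if and only if there exist integers $N=2k$ with $k\ge 1$ and $n\ge 0$, $(2i+l)$-ary terms $s_i,t_i$ for $i=1,\dots,n$, and, for every word $\alpha$ of length $|\alpha|\le N$ in the alphabet $\{1,\dots,N\}$, terms $L_\alpha,R_\alpha$ in the variables $\vec X$, such that $\mathcal V$ satisfies the following identities: 1. if $|\alpha|=N$: $L_\alpha(\rho(\vec X))\approx R_\alpha(\rho(\vec X))$ and $L_\alpha(\rho^*(\vec X))\approx R_\alpha(\rho^*(\vec X))$; 2. for the empty word $\varepsilon$: $x\approx L_\varepsilon(\vec X)$, $R_\varepsilon(\vec X)\approx y$, and $C(\rho,\varepsilon,1,N)$; 3. if $0<|\alpha|<N$ and $|\alpha|$ is even: $C(\rho,\alpha,1,k)$ and $C(\rho^*,\alpha,k+1,N)$; 4. if $0<|\alpha|<N$ and $|\alpha|$ is odd: $C(\sigma,\alpha,1,k)$ and $C(\sigma^*,\alpha,k+1,N)$. -/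

import Mathlib

universe u v w

namespace MalcevLDP

open FirstOrder FirstOrder.Language

section Algebras

variable (L : FirstOrder.Language.{u, v})

/-- A congruence of an algebra `A`: an equivalence relation compatible with all operations. -/
structure Congruence (A : Type w) [L.Structure A] extends Setoid A where
  compatible : ∀ {m : ℕ} (f : L.Functions m) (a b : Fin m → A),
    (∀ i, r (a i) (b i)) → r (Structure.funMap f a) (Structure.funMap f b)

variable {L}

/-- `θ ⋄ θ' = Δ`: `θ` and `θ'` are complementary factor congruences, that is, they are the kernels
of the two canonical projections of a representation of `A` as a direct product `B × C`. A
homomorphism `A → B × C` is the same as a pair of homomorphisms `f : A → B`, `g : A → C`. -/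
def ComplementaryFactor {A : Type w} [L.Structure A] (θ θ' : Congruence L A) : Prop :=
  ∃ (B C : Type w) (_ : L.Structure B) (_ : L.Structure C) (f : A →[L] B) (g : A →[L] C),
    Function.Bijective (fun a => (f a, g a)) ∧
    (∀ a b, θ.r a b ↔ f a = f b) ∧ (∀ a b, θ'.r a b ↔ g a = g b)

/-- The value of a closed term in an algebra. -/
def closedVal (A : Type w) [L.Structure A] (c : L.Term Empty) : A :=
  c.realize (fun i => i.elim)

/-- `A` belongs to the variety axiomatized by the set of equations `E`. -/
def InVariety (E : Set (L.Term ℕ × L.Term ℕ)) (A : Type w) [L.Structure A] : Prop :=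
  ∀ p ∈ E, ∀ a : ℕ → A, p.1.realize a = p.2.realize a

/-- The identity `p ≈ q` holds in the variety axiomatized by `E`. Algebras are non-empty and live
in a universe that contains the free algebras of the variety. -/
def Identity (E : Set (L.Term ℕ × L.Term ℕ)) {X : Type} (p q : L.Term X) : Prop :=
  ∀ (A : Type (max u w)) [L.Structure A] [Nonempty A], InVariety E A →
    ∀ a : X → A, p.realize a = q.realize a

/-- The variety axiomatized by `E` is a variety with `0⃗ & 1⃗`, witnessed by the tuples of closed
terms `zero` and `one`: it satisfies `0⃗ = 1⃗ → x = y`. -/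
def HasZeroOne (E : Set (L.Term ℕ × L.Term ℕ)) {l : ℕ} (zero one : Fin l → L.Term Empty) : Prop :=
  ∀ (A : Type (max u w)) [L.Structure A] [Nonempty A], InVariety E A →
    (∀ i, closedVal A (zero i) = closedVal A (one i)) → ∀ x y : A, x = y

/-- `0⃗ θ e⃗ θ' 1⃗`. -/
def Links {l : ℕ} (zero one : Fin l → L.Term Empty) {A : Type w} [L.Structure A]
    (θ : Congruence L A) (e : Fin l → A) (θ' : Congruence L A) : Prop :=
  ∀ i, θ.r (closedVal A (zero i)) (e i) ∧ θ'.r (e i) (closedVal A (one i))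

/-- The Left Determining Property. -/
def LeftDeterminingProperty (E : Set (L.Term ℕ × L.Term ℕ)) {l : ℕ}
    (zero one : Fin l → L.Term Empty) : Prop :=
  ∀ (A : Type (max u w)) [L.Structure A] [Nonempty A], InVariety E A →
    ∀ (e : Fin l → A) (φ φ' θ θ' : Congruence L A),
      ComplementaryFactor φ φ' → ComplementaryFactor θ θ' →
      Links zero one θ e θ' → Links zero one φ e φ' → θ = φ

end Algebras

/-- The variables `x, y, z₁, …, z_l, x₁, y₁, …, x_m, y_m` (indices are counted from `0`). -/
inductive Var (l m : ℕ) : Type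
  | x : Var l m
  | y : Var l m
  | z (i : Fin l) : Var l m
  | xs (j : Fin m) : Var l m
  | ys (j : Fin m) : Var l m

section Substitutions

variable {L : FirstOrder.Language.{u, v}} {l n : ℕ}

/-- A closed term, regarded as a term in arbitrary variables. -/
def closedTerm {X : Type} (c : L.Term Empty) : L.Term X :=
  c.relabel (fun i => i.elim)

/-- The component `x_j` of the recursion that fixes `x`, sends `y` to `y₀` and `z⃗` to `z₀`,
fixes every `y_j`, and puts `x_j := s_j(x, y, z⃗, x₁, y₁, …, x_{j-1}, y_{j-1})`. -/
def recX (s : ∀ j : Fin n, L.Term (Var l j)) (y₀ : L.Term (Var l n))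
    (z₀ : Fin l → L.Term (Var l n)) (j : Fin n) : L.Term (Var l n) :=
  (s j).subst fun
    | .x => Term.var .x
    | .y => y₀
    | .z i => z₀ i
    | .xs i => recX s y₀ z₀ ⟨i, i.isLt.trans j.isLt⟩
    | .ys i => Term.var (.ys ⟨i, i.isLt.trans j.isLt⟩)
termination_by j.val
decreasing_by exact i.isLt

/-- The component `y_j` of the recursion that fixes `x`, `y` and every `x_j`, sends `z⃗` to `z₀`,
and puts `y_j := s_j(x, y, z⃗, x₁, y₁, …, x_{j-1}, y_{j-1})`. -/
def recY (s : ∀ j : Fin n, L.Term (Var l j))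
    (z₀ : Fin l → L.Term (Var l n)) (j : Fin n) : L.Term (Var l n) :=
  (s j).subst fun
    | .x => Term.var .x
    | .y => Term.var .y
    | .z i => z₀ i
    | .xs i => Term.var (.xs ⟨i, i.isLt.trans j.isLt⟩)
    | .ys i => recY s z₀ ⟨i, i.isLt.trans j.isLt⟩
termination_by j.val
decreasing_by exact i.isLt

variable (zero one : Fin l → L.Term Empty) (s t : ∀ j : Fin n, L.Term (Var l j))

/-- The tuple of terms `σ(X⃗)`. -/
def sigma : Var l n → L.Term (Var l n)
  | .x => Term.var .x
  | .y => Term.var .x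
  | .z i => closedTerm (zero i)
  | .xs j => recX s (Term.var .x) (fun i => closedTerm (zero i)) j
  | .ys j => Term.var (.ys j)

/-- The tuple of terms `σ*(X⃗)`. -/
def sigmaStar : Var l n → L.Term (Var l n)
  | .x => Term.var .x
  | .y => Term.var .y
  | .z i => closedTerm (one i)
  | .xs j => recX t (Term.var .y) (fun i => closedTerm (one i)) j
  | .ys j => Term.var (.ys j)

/-- The tuple of terms `ρ(X⃗)`. -/
def rho : Var l n → L.Term (Var l n)
  | .x => Term.var .x
  | .y => Term.var .y
  | .z i => closedTerm (zero i)
  | .xs j => Term.var (.xs j)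
  | .ys j => recY s (fun i => closedTerm (zero i)) j

/-- The tuple of terms `ρ*(X⃗)`. -/
def rhoStar : Var l n → L.Term (Var l n)
  | .x => Term.var .x
  | .y => Term.var .y
  | .z i => closedTerm (one i)
  | .xs j => Term.var (.xs j)
  | .ys j => recY t (fun i => closedTerm (one i)) j

end Substitutions

/-- `α` is a word in the alphabet `{1, …, N}`. -/
def IsWord (N : ℕ) (α : List ℕ) : Prop := ∀ a ∈ α, 1 ≤ a ∧ a ≤ N

section System

variable {L : FirstOrder.Language.{u, v}} {l n : ℕ}

/-- One block of identities at a word `α`, relative to a substitution `τ` and letters `p ≤ q`: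
`L_α(τ) ≈ L_{αp}(τ)`, `R_{αj}(τ) ≈ L_{α(j+1)}(τ)` for `p ≤ j ≤ q - 1`, `R_{αq}(τ) ≈ R_α(τ)`. -/
structure Chain (E : Set (L.Term ℕ × L.Term ℕ)) (LL RR : List ℕ → L.Term (Var l n))
    (τ : Var l n → L.Term (Var l n)) (α : List ℕ) (p q : ℕ) : Prop where
  first : Identity.{u, v, w} E ((LL α).subst τ) ((LL (α ++ [p])).subst τ)
  step : ∀ j, p ≤ j → j < q →
    Identity.{u, v, w} E ((RR (α ++ [j])).subst τ) ((LL (α ++ [j + 1])).subst τ)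
  last : Identity.{u, v, w} E ((RR (α ++ [q])).subst τ) ((RR α).subst τ)

/-- The system of identities, with `N = 2 * k`. Only the terms `LL α`, `RR α` for words `α` of
length at most `N` in the alphabet `{1, …, N}` occur in it. -/
structure MalcevSystem (E : Set (L.Term ℕ × L.Term ℕ)) (zero one : Fin l → L.Term Empty) (k : ℕ)
    (s t : ∀ j : Fin n, L.Term (Var l j)) (LL RR : List ℕ → L.Term (Var l n)) : Prop where
  top_rho : ∀ α, IsWord (2 * k) α → α.length = 2 * k →
    Identity.{u, v, w} E ((LL α).subst (rho zero s)) ((RR α).subst (rho zero s))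
  top_rhoStar : ∀ α, IsWord (2 * k) α → α.length = 2 * k →
    Identity.{u, v, w} E ((LL α).subst (rhoStar one t)) ((RR α).subst (rhoStar one t))
  empty_left : Identity.{u, v, w} E (Term.var Var.x) (LL [])
  empty_right : Identity.{u, v, w} E (RR []) (Term.var Var.y)
  empty_rho : Chain.{u, v, w} E LL RR (rho zero s) [] 1 (2 * k)
  even_rho : ∀ α, IsWord (2 * k) α → 0 < α.length → α.length < 2 * k → Even α.length →
    Chain.{u, v, w} E LL RR (rho zero s) α 1 k
  even_rhoStar : ∀ α, IsWord (2 * k) α → 0 < α.length → α.length < 2 * k → Even α.length →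
    Chain.{u, v, w} E LL RR (rhoStar one t) α (k + 1) (2 * k)
  odd_sigma : ∀ α, IsWord (2 * k) α → 0 < α.length → α.length < 2 * k → Odd α.length →
    Chain.{u, v, w} E LL RR (sigma zero s) α 1 k
  odd_sigmaStar : ∀ α, IsWord (2 * k) α → 0 < α.length → α.length < 2 * k → Odd α.length →
    Chain.{u, v, w} E LL RR (sigmaStar one t) α (k + 1) (2 * k)

end System

end MalcevLDP

/-! Sufficiency. Given the identities and the congruences in `A`, take `x θ y`, put `z = e`, and
choose `x_j`, `y_j` recursively: `x_j` is the element `θ`-related to `s_j` and `θ'`-related to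
`t_j`, and `y_j` is the same with `φ`, `φ'`. Under this valuation each of the four substitutions
moves every variable only within its own congruence. Descending induction on the length of `α` gives
`L_α = R_α` for nonempty `α`, because complementary congruences meet in equality. At the empty word
only `φ` is available, and what remains is `x φ y` (`MalcevSystem.rel_of_rel`). Exchanging the two
pairs gives equality of `θ` and `φ`.

Necessity. The expression algebra `GenericAlg` has two formal operations: `right` solves the factor
problem for the `φ`-pair and `left` for the `θ`-pair. Two pairs of congruences `Θ i`, `Θ' i` impose
the required relations, and `x`, `y` are identified in the lower `left` congruence. Modulo the
congruence `limitCong`, the joins become complementary factor congruences linked by the `z i`, so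
the Left Determining Property puts `(x, y)` in the join belonging to the lower `right` congruence.
`limitCong` is a union of finite levels, so this membership has a finite witness (`exists_link`),
which unfolds into a tree of pairs indexed by words (`exists_tree`). Only finitely many `left a b`,
`right a b` occur in it. Listing the pairs `(a, b)` so that each is built from earlier ones yields
`s_j`, `t_j` (`exists_enumeration`), and relations in the four congruences turn into identities
under the four substitutions (`identity_of_cong`). -/

namespace MalcevLDP

open FirstOrder FirstOrder.Language

/-! ### Congruences and complementary factor congruences -/

section Congruences

variable {L : FirstOrder.Language.{u, v}}

namespace Congruence

variable {A : Type w} [L.Structure A]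

theorem refl (θ : Congruence L A) (a : A) : θ.r a a := θ.iseqv.refl a

theorem symm (θ : Congruence L A) {a b : A} (h : θ.r a b) : θ.r b a := θ.iseqv.symm h

theorem trans (θ : Congruence L A) {a b c : A} (h : θ.r a b) (h' : θ.r b c) : θ.r a c :=
  θ.iseqv.trans h h'

theorem ext_r {θ φ : Congruence L A} (h : ∀ a b, θ.r a b ↔ φ.r a b) : θ = φ := by
  obtain ⟨θ, hθ⟩ := θ
  obtain ⟨φ, hφ⟩ := φ
  have : θ = φ := Setoid.ext h
  subst this
  rfl

theorem realize (θ : Congruence L A) {X : Type*} (p : L.Term X) {a b : X → A}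
    (h : ∀ i, θ.r (a i) (b i)) : θ.r (p.realize a) (p.realize b) := by
  induction p with
  | var i => exact h i
  | func f ts ih => exact θ.compatible f _ _ ih

/-- The equality congruence. -/
def equality (A : Type w) [L.Structure A] : Congruence L A where
  r := Eq
  iseqv := eq_equivalence
  compatible _ _ _ h := congrArg _ (funext h)

end Congruence

theorem ComplementaryFactor.eq_of_rel {A : Type w} [L.Structure A] {θ θ' : Congruence L A}
    (h : ComplementaryFactor θ θ') {a b : A} (h₁ : θ.r a b) (h₂ : θ'.r a b) : a = b := by
  obtain ⟨B, C, _, _, f, g, hfg, hf, hg⟩ := h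
  exact hfg.1 (Prod.ext ((hf a b).1 h₁) ((hg a b).1 h₂))

theorem ComplementaryFactor.exists_rel {A : Type w} [L.Structure A] {θ θ' : Congruence L A}
    (h : ComplementaryFactor θ θ') (a b : A) : ∃ c, θ.r c a ∧ θ'.r c b := by
  obtain ⟨B, C, _, _, f, g, hfg, hf, hg⟩ := h
  obtain ⟨c, hc⟩ := hfg.2 (f a, g b)
  exact ⟨c, (hf _ _).2 (congrArg Prod.fst hc), (hg _ _).2 (congrArg Prod.snd hc)⟩

@[simp]
theorem realize_closedTerm {A : Type w} [L.Structure A] {X : Type} (c : L.Term Empty) (a : X → A) :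
    (closedTerm c : L.Term X).realize a = closedVal A c := by
  rw [closedTerm, closedVal, Term.realize_relabel]
  congr 1
  funext i
  exact i.elim

end Congruences

/-! ### The recursive substitutions under valuations -/

section Valuations

variable {L : FirstOrder.Language.{u, v}} {l n : ℕ} {A : Type w}

/-- The restriction of a valuation to the variables of index below `j`. -/
def restrict (a : Var l n → A) (j : Fin n) : Var l j → A
  | .x => a .x
  | .y => a .y
  | .z i => a (.z i)
  | .xs i => a (.xs ⟨i, i.isLt.trans j.isLt⟩)
  | .ys i => a (.ys ⟨i, i.isLt.trans j.isLt⟩)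

variable [L.Structure A]

/-- If `b` obeys the defining recursion modulo `Θ`, it agrees modulo `Θ` with the exact solution, by
strong induction on the index. Sufficiency uses a factor congruence for `Θ`; necessity uses
equality. -/
theorem recX_rel (Θ : Congruence L A) (s : ∀ j : Fin n, L.Term (Var l j)) (y₀ : L.Term (Var l n))
    (z₀ : Fin l → L.Term (Var l n)) {a b : Var l n → A} (hx : Θ.r (a .x) (b .x))
    (hy : Θ.r (y₀.realize a) (b .y)) (hz : ∀ i, Θ.r ((z₀ i).realize a) (b (.z i)))
    (hys : ∀ j, Θ.r (a (.ys j)) (b (.ys j)))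
    (hxs : ∀ j, Θ.r (b (.xs j)) ((s j).realize (restrict b j))) (j : Fin n) :
    Θ.r ((recX s y₀ z₀ j).realize a) (b (.xs j)) := by
  obtain ⟨j, hj⟩ := j
  induction j using Nat.strong_induction_on with
  | _ j ih =>
    rw [recX, Term.realize_subst]
    refine Θ.trans (Θ.realize _ fun i => ?_) (Θ.symm (hxs _))
    cases i with
    | x => exact hx
    | y => exact hy
    | z i => exact hz i
    | xs i => exact ih i i.isLt _
    | ys i => exact hys _

theorem recY_rel (Θ : Congruence L A) (s : ∀ j : Fin n, L.Term (Var l j))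
    (z₀ : Fin l → L.Term (Var l n)) {a b : Var l n → A} (hx : Θ.r (a .x) (b .x))
    (hy : Θ.r (a .y) (b .y)) (hz : ∀ i, Θ.r ((z₀ i).realize a) (b (.z i)))
    (hxs : ∀ j, Θ.r (a (.xs j)) (b (.xs j)))
    (hys : ∀ j, Θ.r (b (.ys j)) ((s j).realize (restrict b j))) (j : Fin n) :
    Θ.r ((recY s z₀ j).realize a) (b (.ys j)) := by
  obtain ⟨j, hj⟩ := j
  induction j using Nat.strong_induction_on with
  | _ j ih =>
    rw [recY, Term.realize_subst]
    refine Θ.trans (Θ.realize _ fun i => ?_) (Θ.symm (hys _))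
    cases i with
    | x => exact hx
    | y => exact hy
    | z i => exact hz i
    | xs i => exact hxs _
    | ys i => exact ih i i.isLt _

variable (zero one : Fin l → L.Term Empty) (s t : ∀ j : Fin n, L.Term (Var l j))

theorem sigma_rel (Θ : Congruence L A) {a b : Var l n → A} (hx : Θ.r (a .x) (b .x))
    (hy : Θ.r (a .x) (b .y)) (hz : ∀ i, Θ.r (closedVal A (zero i)) (b (.z i)))
    (hys : ∀ j, Θ.r (a (.ys j)) (b (.ys j)))
    (hxs : ∀ j, Θ.r (b (.xs j)) ((s j).realize (restrict b j))) (p : Var l n) :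
    Θ.r ((sigma zero s p).realize a) (b p) := by
  cases p with
  | x => exact hx
  | y => exact hy
  | z i => simpa [sigma] using hz i
  | xs j => exact recX_rel Θ s (Term.var .x) _ hx hy (fun i => by simpa using hz i) hys hxs j
  | ys j => exact hys j

theorem sigmaStar_rel (Θ : Congruence L A) {a b : Var l n → A} (hx : Θ.r (a .x) (b .x))
    (hy : Θ.r (a .y) (b .y)) (hz : ∀ i, Θ.r (closedVal A (one i)) (b (.z i)))
    (hys : ∀ j, Θ.r (a (.ys j)) (b (.ys j)))
    (hxs : ∀ j, Θ.r (b (.xs j)) ((t j).realize (restrict b j))) (p : Var l n) :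
    Θ.r ((sigmaStar one t p).realize a) (b p) := by
  cases p with
  | x => exact hx
  | y => exact hy
  | z i => simpa [sigmaStar] using hz i
  | xs j => exact recX_rel Θ t (Term.var .y) _ hx hy (fun i => by simpa using hz i) hys hxs j
  | ys j => exact hys j

theorem rho_rel (Θ : Congruence L A) {a b : Var l n → A} (hx : Θ.r (a .x) (b .x))
    (hy : Θ.r (a .y) (b .y)) (hz : ∀ i, Θ.r (closedVal A (zero i)) (b (.z i)))
    (hxs : ∀ j, Θ.r (a (.xs j)) (b (.xs j)))
    (hys : ∀ j, Θ.r (b (.ys j)) ((s j).realize (restrict b j))) (p : Var l n) :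
    Θ.r ((rho zero s p).realize a) (b p) := by
  cases p with
  | x => exact hx
  | y => exact hy
  | z i => simpa [rho] using hz i
  | xs j => exact hxs j
  | ys j => exact recY_rel Θ s _ hx hy (fun i => by simpa using hz i) hxs hys j

/-- The two `ρ`-substitutions differ only in their parameters, so `rho_rel` serves both. The
`σ`-substitutions also differ at `y`, hence have separate lemmas. -/
theorem rhoStar_eq_rho : rhoStar one t = rho one t := by
  funext p
  cases p <;> rfl

/-- The valuation with the given values at the variables. -/
def Var.elim {l m : ℕ} {A : Type w} (a b : A) (e : Fin l → A) (c d : Fin m → A) : Var l m → A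
  | .x => a
  | .y => b
  | .z i => e i
  | .xs i => c i
  | .ys i => d i

/-- The values at `x_j` and `y_j` of the valuation built by recursion on the index, where `pick` and
`pick'` give them in terms of the values of `s_j` and `t_j` at the previous variables. -/
noncomputable def recVal (pick pick' : A → A → A) (a b : A) (e : Fin l → A) (j : Fin n) : A × A :=
  let val : Var l j → A := Var.elim a b e
    (fun i => (recVal pick pick' a b e ⟨i, i.isLt.trans j.isLt⟩).1)
    (fun i => (recVal pick pick' a b e ⟨i, i.isLt.trans j.isLt⟩).2)
  (pick ((s j).realize val) ((t j).realize val), pick' ((s j).realize val) ((t j).realize val))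
termination_by j.val
decreasing_by all_goals exact i.isLt

theorem exists_valuation (pick pick' : A → A → A) (a b : A) (e : Fin l → A) :
    ∃ c : Var l n → A, c .x = a ∧ c .y = b ∧ (∀ i, c (.z i) = e i) ∧
      (∀ j, c (.xs j) = pick ((s j).realize (restrict c j)) ((t j).realize (restrict c j))) ∧
      ∀ j, c (.ys j) = pick' ((s j).realize (restrict c j)) ((t j).realize (restrict c j)) := by
  let c : Var l n → A := Var.elim a b e (fun j => (recVal s t pick pick' a b e j).1)
    (fun j => (recVal s t pick pick' a b e j).2)
  have key (j : Fin n) : recVal s t pick pick' a b e j =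
      (pick ((s j).realize (restrict c j)) ((t j).realize (restrict c j)),
        pick' ((s j).realize (restrict c j)) ((t j).realize (restrict c j))) := by
    have : restrict c j = Var.elim a b e
        (fun i => (recVal s t pick pick' a b e ⟨i, i.isLt.trans j.isLt⟩).1)
        (fun i => (recVal s t pick pick' a b e ⟨i, i.isLt.trans j.isLt⟩).2) := by
      funext p
      cases p <;> rfl
    rw [recVal, this]
  exact ⟨c, rfl, rfl, fun _ => rfl, fun j => congrArg Prod.fst (key j),
    fun j => congrArg Prod.snd (key j)⟩

end Valuations

/-! ### The identities imply the Left Determining Property -/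

section Sufficiency

variable {L : FirstOrder.Language.{u, v}} {l n : ℕ} {E : Set (L.Term ℕ × L.Term ℕ)}
  {A : Type (max u w)} [L.Structure A] [Nonempty A]

theorem Identity.rel (hA : InVariety E A) (Θ : Congruence L A)
    {τ : Var l n → L.Term (Var l n)} {a : Var l n → A} (hτ : ∀ p, Θ.r ((τ p).realize a) (a p))
    {p q : L.Term (Var l n)} (h : Identity.{u, v, w} E (p.subst τ) (q.subst τ)) :
    Θ.r (p.realize a) (q.realize a) := by
  have h' := h A hA a
  rw [Term.realize_subst, Term.realize_subst] at h'
  refine Θ.trans (Θ.symm (Θ.realize p hτ)) ?_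
  rw [h']
  exact Θ.realize q hτ

/-- Once the two terms at each child agree in `A`, the block of identities becomes an unbroken
`Θ`-path from `L_α` to `R_α`. -/
theorem Chain.rel (hA : InVariety E A) (Θ : Congruence L A)
    {τ : Var l n → L.Term (Var l n)} {a : Var l n → A} (hτ : ∀ p, Θ.r ((τ p).realize a) (a p))
    {LL RR : List ℕ → L.Term (Var l n)} {α : List ℕ} {p q : ℕ} (hpq : p ≤ q)
    (h : Chain.{u, v, w} E LL RR τ α p q)
    (heq : ∀ j, p ≤ j → j ≤ q → (LL (α ++ [j])).realize a = (RR (α ++ [j])).realize a) :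
    Θ.r ((LL α).realize a) ((RR α).realize a) := by
  have key : ∀ j, p ≤ j → j ≤ q → Θ.r ((LL α).realize a) ((RR (α ++ [j])).realize a) := by
    intro j hj
    induction j, hj using Nat.le_induction with
    | base =>
      intro hq
      rw [← heq p le_rfl hq]
      exact h.first.rel hA Θ hτ
    | succ j hj ih =>
      intro hq
      rw [← heq (j + 1) (by omega) hq]
      exact Θ.trans (ih (by omega)) ((h.step j hj hq).rel hA Θ hτ)
  exact Θ.trans (key q hpq le_rfl) (h.last.rel hA Θ hτ)

theorem IsWord.append {N : ℕ} {α : List ℕ} (h : IsWord N α) {j : ℕ} (h₁ : 1 ≤ j) (h₂ : j ≤ N) :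
    IsWord N (α ++ [j]) := by
  intro a ha
  rcases List.mem_append.1 ha with ha | ha
  · exact h a ha
  · rw [List.mem_singleton.1 ha]
    exact ⟨h₁, h₂⟩

theorem MalcevSystem.rel_of_rel {zero one : Fin l → L.Term Empty} {k : ℕ} (hk : 0 < k)
    {s t : ∀ j : Fin n, L.Term (Var l j)} {LL RR : List ℕ → L.Term (Var l n)}
    (h : MalcevSystem.{u, v, w} E zero one k s t LL RR) (hA : InVariety E A) {e : Fin l → A}
    {φ φ' θ θ' : Congruence L A} (hφ : ComplementaryFactor φ φ') (hθ : ComplementaryFactor θ θ')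
    (lθ : Links zero one θ e θ') (lφ : Links zero one φ e φ') {a b : A} (hab : θ.r a b) :
    φ.r a b := by
  -- These choices solve the two factor problems: `pick` supplies the `x_j` and `pick'` the `y_j`.
  choose pick hpick using hθ.exists_rel
  choose pick' hpick' using hφ.exists_rel
  obtain ⟨c, hcx, hcy, hcz, hcxs, hcys⟩ := exists_valuation s t pick pick' a b e
  have hσ : ∀ p, θ.r ((sigma zero s p).realize c) (c p) :=
    sigma_rel zero s θ (θ.refl _) (by rwa [hcx, hcy]) (fun i => by rw [hcz]; exact (lθ i).1)
      (fun _ => θ.refl _) (fun j => by rw [hcxs]; exact (hpick _ _).1)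
  have hσ' : ∀ p, θ'.r ((sigmaStar one t p).realize c) (c p) :=
    sigmaStar_rel one t θ' (θ'.refl _) (θ'.refl _)
      (fun i => by rw [hcz]; exact θ'.symm (lθ i).2)
      (fun _ => θ'.refl _) (fun j => by rw [hcxs]; exact (hpick _ _).2)
  have hρ : ∀ p, φ.r ((rho zero s p).realize c) (c p) :=
    rho_rel zero s φ (φ.refl _) (φ.refl _) (fun i => by rw [hcz]; exact (lφ i).1)
      (fun _ => φ.refl _) (fun j => by rw [hcys]; exact (hpick' _ _).1)
  have hρ' : ∀ p, φ'.r ((rhoStar one t p).realize c) (c p) := by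
    rw [rhoStar_eq_rho]
    exact rho_rel one t φ' (φ'.refl _) (φ'.refl _)
      (fun i => by rw [hcz]; exact φ'.symm (lφ i).2)
      (fun _ => φ'.refl _) (fun j => by rw [hcys]; exact (hpick' _ _).2)
  -- Induction on the distance `m` from the leaves. Even lengths use the pair `φ`, `φ'` and odd
  -- lengths the pair `θ`, `θ'`.
  have key : ∀ m α, IsWord (2 * k) α → 0 < α.length → α.length + m = 2 * k →
      (LL α).realize c = (RR α).realize c := by
    intro m
    induction m with
    | zero =>
      intro α hα _ hlen
      exact hφ.eq_of_rel ((h.top_rho α hα hlen).rel hA φ hρ)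
        ((h.top_rhoStar α hα hlen).rel hA φ' hρ')
    | succ m ih =>
      intro α hα hpos hlen
      have hch : ∀ j, 1 ≤ j → j ≤ 2 * k →
          (LL (α ++ [j])).realize c = (RR (α ++ [j])).realize c := fun j h₁ h₂ =>
        ih _ (hα.append h₁ h₂) (by simp) (by simp; omega)
      rcases Nat.even_or_odd α.length with hev | hodd
      · exact hφ.eq_of_rel
          ((h.even_rho α hα hpos (by omega) hev).rel hA φ hρ (by omega)
            fun j h₁ h₂ => hch j h₁ (by omega))
          ((h.even_rhoStar α hα hpos (by omega) hev).rel hA φ' hρ' (by omega)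
            fun j h₁ h₂ => hch j (by omega) h₂)
      · exact hθ.eq_of_rel
          ((h.odd_sigma α hα hpos (by omega) hodd).rel hA θ hσ (by omega)
            fun j h₁ h₂ => hch j h₁ (by omega))
          ((h.odd_sigmaStar α hα hpos (by omega) hodd).rel hA θ' hσ' (by omega)
            fun j h₁ h₂ => hch j (by omega) h₂)
  -- The root has only a `ρ`-chain, so it gives a `φ`-relation instead of an equality.
  have hroot : φ.r ((LL []).realize c) ((RR []).realize c) :=
    h.empty_rho.rel hA φ hρ (by omega) fun j h₁ h₂ =>
      key (2 * k - 1) [j] (by simpa [IsWord] using ⟨h₁, h₂⟩) (by simp) (by simp; omega)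
  rw [← h.empty_left A hA c, h.empty_right A hA c] at hroot
  simpa [hcx, hcy] using hroot

end Sufficiency

/-! ### Alternating compositions of relations -/

section Links

variable {A : Type w}

/-- The relation `R ∘ (S ∘ R) ∘ ⋯ ∘ (S ∘ R)` with `k` blocks `S ∘ R`. -/
def Link (R S : A → A → Prop) : ℕ → A → A → Prop
  | 0 => R
  | k + 1 => fun a b => ∃ c d, R a c ∧ S c d ∧ Link R S k d b

variable {R S S' : A → A → Prop}

theorem Link.mono_right (hS : ∀ a b, S a b → S' a b) :
    ∀ {k : ℕ} {a b : A}, Link R S k a b → Link R S' k a b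
  | 0, _, _, h => h
  | _ + 1, _, _, ⟨c, d, hc, hcd, hd⟩ => ⟨c, d, hc, hS _ _ hcd, hd.mono_right hS⟩

theorem Link.mono_length (hR : ∀ a, R a a) (hS : ∀ a, S a a) {k m : ℕ} (hkm : k ≤ m) {a b : A}
    (h : Link R S k a b) : Link R S m a b := by
  induction m, hkm using Nat.le_induction with
  | base => exact h
  | succ m _ ih => exact ⟨a, a, hR a, hS a, ih⟩

theorem Link.mono (hR : ∀ a, R a a) (hS : ∀ a b, S a b → S' a b) (hS' : ∀ a, S' a a) {k m : ℕ}
    (hkm : k ≤ m) {a b : A} (h : Link R S k a b) : Link R S' m a b :=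
  (h.mono_right hS).mono_length hR hS' hkm

theorem Link.trans_left (hR : ∀ a b c, R a b → R b c → R a c) {k : ℕ} {a b c : A} (hab : R a b)
    (h : Link R S k b c) : Link R S k a c := by
  cases k with
  | zero => exact hR _ _ _ hab h
  | succ k =>
    obtain ⟨d, e, hd, hde, he⟩ := h
    exact ⟨d, e, hR _ _ _ hab hd, hde, he⟩

theorem Link.trans (hR : ∀ a b c, R a b → R b c → R a c) {m : ℕ} :
    ∀ {k : ℕ} {a b c : A}, Link R S k a b → Link R S m b c → Link R S (k + m) a c
  | 0, _, _, _, h, h' => by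
    rw [Nat.zero_add]
    exact Link.trans_left hR h h'
  | k + 1, _, _, _, ⟨d, e, hd, hde, he⟩, h' => by
    rw [Nat.add_right_comm]
    exact ⟨d, e, hd, hde, Link.trans hR he h'⟩

theorem Link.snoc {k : ℕ} {a b c d : A} (h : Link R S k a b) (hbc : S b c) (hcd : R c d) :
    Link R S (k + 1) a d := by
  induction k generalizing a with
  | zero => exact ⟨b, c, h, hbc, hcd⟩
  | succ k ih =>
    obtain ⟨e, f, he, hef, hf⟩ := h
    exact ⟨e, f, he, hef, ih hf⟩

theorem Link.symm (hR : ∀ a b, R a b → R b a) (hS : ∀ a b, S a b → S b a) :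
    ∀ {k : ℕ} {a b : A}, Link R S k a b → Link R S k b a
  | 0, _, _, h => hR _ _ h
  | _ + 1, _, _, ⟨_, _, hc, hcd, hd⟩ => (Link.symm hR hS hd).snoc (hS _ _ hcd) (hR _ _ hc)

/-- The pairs `c p, …, c q` form a chain from `a` to `b` whose consecutive pairs are joined
by `R`. -/
structure IsChainSeq (R : A → A → Prop) (c : ℕ → A × A) (a b : A) (p q : ℕ) : Prop where
  first : R a (c p).1
  step : ∀ j, p ≤ j → j < q → R (c j).2 (c (j + 1)).1
  last : R (c q).2 b

theorem IsChainSeq.congr {c c' : ℕ → A × A} {a b : A} {p q : ℕ} (hpq : p ≤ q)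
    (h : IsChainSeq R c a b p q) (hc : ∀ j, p ≤ j → j ≤ q → c' j = c j) :
    IsChainSeq R c' a b p q where
  first := by
    rw [hc p le_rfl hpq]
    exact h.first
  step j h₁ h₂ := by
    rw [hc j h₁ h₂.le, hc (j + 1) (by omega) h₂]
    exact h.step j h₁ h₂
  last := by
    rw [hc q hpq le_rfl]
    exact h.last

/-- The `k + 1` steps along `S` are recorded as pairs numbered from `p`. The free starting index
lets the two chains at a word use the letters `1, …, k` and `k + 1, …, 2k`. -/
theorem Link.exists_isChainSeq {k : ℕ} {a b : A} (h : Link R S (k + 1) a b) (p : ℕ) :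
    ∃ c, IsChainSeq R c a b p (p + k) ∧ ∀ j, p ≤ j → j ≤ p + k → S (c j).1 (c j).2 := by
  induction k generalizing a p with
  | zero =>
    obtain ⟨d, e, hd, hde, he⟩ := h
    exact ⟨fun _ => (d, e), ⟨hd, fun j _ _ => by omega, he⟩, fun _ _ _ => hde⟩
  | succ k ih =>
    obtain ⟨d, e, hd, hde, he⟩ := h
    obtain ⟨c, hc, hcS⟩ := ih he (p + 1)
    have hne : ∀ j, p < j → (if j = p then (d, e) else c j) = c j := fun j hj =>
      if_neg (by omega)
    refine ⟨fun j => if j = p then (d, e) else c j, ⟨by simpa using hd, fun j h₁ h₂ => ?_, ?_⟩,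
      fun j h₁ h₂ => ?_⟩
    · rw [hne (j + 1) (by omega)]
      rcases h₁.eq_or_lt with rfl | h₁
      · simpa using hc.first
      · rw [hne j h₁]
        exact hc.step j h₁ (by omega)
    · rw [hne _ (by omega), ← Nat.add_assoc, Nat.add_right_comm]
      exact hc.last
    · rcases h₁.eq_or_lt with rfl | h₁
      · simpa using hde
      · simp only [hne j h₁]
        exact hcS j h₁ (by omega)

end Links

/-! ### Finite approximations of the limit congruence -/

section Levels

variable {L : FirstOrder.Language.{u, v}} {A : Type w} [L.Structure A]

/-- Compatibility of a relation with all operations. -/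
def Compatible (L : FirstOrder.Language.{u, v}) {A : Type w} [L.Structure A]
    (R : A → A → Prop) : Prop :=
  ∀ {m : ℕ} (f : L.Functions m) (a b : Fin m → A),
    (∀ i, R (a i) (b i)) → R (Structure.funMap f a) (Structure.funMap f b)

theorem Link.compatible {R S : A → A → Prop} (hR : Compatible L R) (hS : Compatible L S) (k : ℕ) :
    Compatible L (Link R S k) := by
  intro m f a b h
  induction k generalizing a with
  | zero => exact hR f a b h
  | succ k ih =>
    choose c d hc hcd hd using h
    exact ⟨_, _, hR f a c hc, hS f c d hcd, ih d hd⟩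

/-- The union of an increasing sequence of relations, as a congruence. -/
def Congruence.iUnion (r : ℕ → A → A → Prop) (mono : ∀ m n a b, m ≤ n → r m a b → r n a b)
    (refl : ∀ a, r 0 a a) (symm : ∀ n a b, r n a b → r n b a)
    (trans : ∀ n a b c, r n a b → r n b c → ∃ m, r m a c)
    (compat : ∀ n, Compatible L (r n)) : Congruence L A where
  r a b := ∃ n, r n a b
  iseqv := by
    refine ⟨fun a => ⟨0, refl a⟩, fun ⟨n, h⟩ => ⟨n, symm n _ _ h⟩, ?_⟩
    rintro a b c ⟨n, h⟩ ⟨m, h'⟩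
    exact trans (max n m) a b c (mono _ _ _ _ (le_max_left _ _) h)
      (mono _ _ _ _ (le_max_right _ _) h')
  compatible f a b h := by
    choose n hn using h
    -- Operations are finitary, so the stages of the arguments have a common bound.
    exact ⟨Finset.univ.sup n, compat _ f a b fun i =>
      mono _ _ _ _ (Finset.le_sup (Finset.mem_univ i)) (hn i)⟩

variable (Θ Θ' : ℕ → Congruence L A)

/-- The approximation of level `i` and width `k` of the smallest congruence `D` with
`(Θ i ∨ D) ∩ (Θ' i ∨ D) = D` for all `i`. -/
def level (k : ℕ) : ℕ → A → A → Prop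
  | 0 => fun a b => (Θ 0).r a b ∧ (Θ' 0).r a b
  | i + 1 => fun a b => Link (Θ (i + 1)).r (level k i) k a b ∧ Link (Θ' (i + 1)).r (level k i) k a b

theorem level_refl (k i : ℕ) (a : A) : level Θ Θ' k i a a := by
  induction i generalizing a with
  | zero => exact ⟨(Θ 0).refl a, (Θ' 0).refl a⟩
  | succ i ih =>
    exact ⟨Link.mono_length (Θ _).refl ih (Nat.zero_le k) ((Θ _).refl a),
      Link.mono_length (Θ' _).refl ih (Nat.zero_le k) ((Θ' _).refl a)⟩

theorem level_symm (k i : ℕ) : ∀ a b : A, level Θ Θ' k i a b → level Θ Θ' k i b a := by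
  induction i with
  | zero => exact fun a b h => ⟨(Θ 0).symm h.1, (Θ' 0).symm h.2⟩
  | succ i ih =>
    exact fun a b h => ⟨h.1.symm (fun _ _ => (Θ _).symm) ih, h.2.symm (fun _ _ => (Θ' _).symm) ih⟩

theorem level_compatible (k i : ℕ) : Compatible L (level Θ Θ' k i) := by
  induction i with
  | zero =>
    exact fun f a b h => ⟨(Θ 0).compatible f a b fun i => (h i).1,
      (Θ' 0).compatible f a b fun i => (h i).2⟩
  | succ i ih =>
    exact fun f a b h => ⟨Link.compatible (Θ _).compatible ih k f a b fun i => (h i).1,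
      Link.compatible (Θ' _).compatible ih k f a b fun i => (h i).2⟩

theorem level_mono_width {k k' : ℕ} (hk : k ≤ k') (i : ℕ) :
    ∀ a b : A, level Θ Θ' k i a b → level Θ Θ' k' i a b := by
  induction i with
  | zero => exact fun a b h => h
  | succ i ih =>
    exact fun a b h => ⟨h.1.mono (Θ _).refl ih (level_refl Θ Θ' k' i) hk,
      h.2.mono (Θ' _).refl ih (level_refl Θ Θ' k' i) hk⟩

theorem Link.of_mem {R S : A → A → Prop} (hR : ∀ a, R a a) (hS : ∀ a, S a a) {k : ℕ} (hk : 0 < k)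
    {a b : A} (h : S a b) : Link R S k a b :=
  Link.mono_length hR hS (k := 1) hk ⟨a, b, hR a, h, hR b⟩

theorem level_mono_index {k : ℕ} (hk : 0 < k) {i i' : ℕ} (hi : i ≤ i') {a b : A}
    (h : level Θ Θ' k i a b) : level Θ Θ' k i' a b := by
  induction i', hi using Nat.le_induction with
  | base => exact h
  | succ j _ ih =>
    exact ⟨Link.of_mem (Θ _).refl (level_refl Θ Θ' k j) hk ih,
      Link.of_mem (Θ' _).refl (level_refl Θ Θ' k j) hk ih⟩

theorem level_mono {k k' i i' : ℕ} (hk : k ≤ k') (hpos : 0 < k') (hi : i ≤ i') {a b : A}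
    (h : level Θ Θ' k i a b) : level Θ Θ' k' i' a b :=
  level_mono_index Θ Θ' hpos hi (level_mono_width Θ Θ' hk i a b h)

theorem link_level_mono (θ : Congruence L A) {k k' i i' m m' : ℕ} (hk : k ≤ k') (hpos : 0 < k')
    (hi : i ≤ i') (hm : m ≤ m') {a b : A} (h : Link θ.r (level Θ Θ' k i) m a b) :
    Link θ.r (level Θ Θ' k' i') m' a b :=
  Link.mono (S := level Θ Θ' k i) θ.refl (fun _ _ => level_mono Θ Θ' hk hpos hi) (level_refl Θ Θ' _ _)
    hm h

/-- The smallest congruence `D` with `(Θ i ∨ D) ∩ (Θ' i ∨ D) = D` for all `i`, when every pair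
`Θ i`, `Θ' i` occurs infinitely often. -/
def limitCong : Congruence L A :=
  .iUnion (fun n => level Θ Θ' (n + 1) n)
    (fun m n _ _ hmn h =>
      level_mono Θ Θ' (Nat.succ_le_succ hmn) n.succ_pos hmn h)
    (level_refl Θ Θ' _ _) (fun _ => level_symm Θ Θ' _ _)
    (fun n a b c h h' => by
      -- Two consecutive level steps form a link of two blocks for any `θ`, so a later level, being
      -- an intersection of such links, absorbs them.
      have key (θ : Congruence L A) : Link θ.r (level Θ Θ' (n + 3) (n + 1)) (n + 3) a c :=
        link_level_mono Θ Θ' θ (k := n + 1) (i := n) (m := 2) (by omega) (by omega) (by omega)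
          (by omega) ⟨a, b, θ.refl a, h, b, c, θ.refl b, h', θ.refl c⟩
      exact ⟨n + 2, key _, key _⟩)
    (fun _ => level_compatible Θ Θ' _ _)

/-- The join of `θ` and `limitCong Θ Θ'`. -/
def joinCong (θ : Congruence L A) : Congruence L A :=
  .iUnion (fun n => Link θ.r (level Θ Θ' (n + 1) n) (n + 1))
    (fun m n _ _ hmn h => link_level_mono Θ Θ' θ (Nat.succ_le_succ hmn) n.succ_pos hmn
      (Nat.succ_le_succ hmn) h)
    (fun a => Link.of_mem θ.refl (level_refl Θ Θ' _ _) Nat.one_pos (level_refl Θ Θ' _ _ a))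
    (fun _ _ _ => Link.symm (fun _ _ => θ.symm) (level_symm Θ Θ' _ _))
    (fun n _ _ _ h h' => ⟨(n + 1) + (n + 1), link_level_mono Θ Θ' θ (k := n + 1) (i := n)
      (m := (n + 1) + (n + 1)) (by omega) (by omega) (by omega) (by omega)
      (Link.trans (R := θ.r) (fun _ _ _ => θ.trans) h h')⟩)
    (fun _ => Link.compatible θ.compatible (level_compatible Θ Θ' _ _) _)

theorem joinCong_of_rel {θ : Congruence L A} {a b : A} (h : θ.r a b) :
    (joinCong Θ Θ' θ).r a b :=
  ⟨0, Link.mono_length θ.refl (level_refl Θ Θ' _ _) (Nat.zero_le _) h⟩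

theorem limitCong_of_rel {a b : A} (h : (Θ 0).r a b) (h' : (Θ' 0).r a b) :
    (limitCong Θ Θ').r a b :=
  ⟨0, h, h'⟩

/-- A pair in both joins already has links of bounded width over a bounded level. Since `θ`, `θ'`
recur later in the sequence, a later level contains exactly the intersection that captures the pair.
-/
theorem limitCong_iff {θ θ' : Congruence L A} (hinf : ∀ n, ∃ i, n ≤ i ∧ Θ (i + 1) = θ ∧
    Θ' (i + 1) = θ') {a b : A} :
    (limitCong Θ Θ').r a b ↔ (joinCong Θ Θ' θ).r a b ∧ (joinCong Θ Θ' θ').r a b := by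
  constructor
  · rintro ⟨n, h⟩
    exact ⟨⟨n, Link.of_mem θ.refl (level_refl Θ Θ' _ _) n.succ_pos h⟩,
      ⟨n, Link.of_mem θ'.refl (level_refl Θ Θ' _ _) n.succ_pos h⟩⟩
  · rintro ⟨⟨n, h⟩, ⟨m, h'⟩⟩
    obtain ⟨i, hi, rfl, rfl⟩ := hinf (max n m)
    exact ⟨i + 1,
      link_level_mono Θ Θ' _ (by omega) (by omega) (by omega) (by omega) h,
      link_level_mono Θ Θ' _ (by omega) (by omega) (by omega) (by omega) h'⟩

end Levels

/-! ### Quotient algebras and factor congruences on them -/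

section Quotients

variable {L : FirstOrder.Language.{u, v}} {A : Type w} [L.Structure A]

namespace Congruence

/-- The quotient algebra. -/
def Quot (θ : Congruence L A) : Type w := Quotient θ.toSetoid

/-- The canonical projection to the quotient algebra. -/
def proj (θ : Congruence L A) (a : A) : θ.Quot := Quotient.mk θ.toSetoid a

theorem proj_eq_proj (θ : Congruence L A) {a b : A} : θ.proj a = θ.proj b ↔ θ.r a b :=
  Quotient.eq (r := θ.toSetoid)

theorem proj_surjective (θ : Congruence L A) : Function.Surjective θ.proj := Quotient.mk_surjective

variable [L.IsAlgebraic]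

noncomputable instance (θ : Congruence L A) : L.Structure θ.Quot where
  funMap f a := θ.proj (Structure.funMap f fun i => (θ.proj_surjective (a i)).choose)
  RelMap r := isEmptyElim r

theorem funMap_proj (θ : Congruence L A) {m : ℕ} (f : L.Functions m) (a : Fin m → A) :
    Structure.funMap f (fun i => θ.proj (a i)) = θ.proj (Structure.funMap f a) :=
  θ.proj_eq_proj.2 <| θ.compatible f _ _ fun i =>
    θ.proj_eq_proj.1 (θ.proj_surjective (θ.proj (a i))).choose_spec

/-- The canonical projection as a homomorphism. -/
noncomputable def projHom (θ : Congruence L A) : A →[L] θ.Quot where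
  toFun := θ.proj
  map_fun' f a := (θ.funMap_proj f a).symm
  map_rel' r := isEmptyElim r

/-- The homomorphism between quotients induced by an inclusion of congruences. -/
noncomputable def factor (d θ : Congruence L A) (h : ∀ a b, d.r a b → θ.r a b) :
    d.Quot →[L] θ.Quot where
  toFun := Quotient.lift θ.proj fun a b hab => θ.proj_eq_proj.2 (h a b hab)
  map_fun' f a := by
    choose b hb using fun i => d.proj_surjective (a i)
    obtain rfl : (fun i => d.proj (b i)) = a := funext hb
    rw [funMap_proj]
    exact (θ.funMap_proj f b).symm
  map_rel' r := isEmptyElim r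

/-- The kernel of a homomorphism. -/
def ker {B : Type*} [L.Structure B] (f : A →[L] B) : Congruence L A where
  r a b := f a = f b
  iseqv := ⟨fun _ => rfl, Eq.symm, Eq.trans⟩
  compatible g a b h := by
    rw [f.map_fun, f.map_fun]
    exact congrArg _ (funext h)

theorem ker_factor_proj {d θ : Congruence L A} (h : ∀ a b, d.r a b → θ.r a b) {a b : A} :
    (ker (factor d θ h)).r (d.proj a) (d.proj b) ↔ θ.r a b :=
  θ.proj_eq_proj

theorem closedVal_quot (θ : Congruence L A) (c : L.Term Empty) :
    closedVal θ.Quot c = θ.proj (closedVal A c) := by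
  have h := HomClass.realize_term θ.projHom (t := c) (v := fun i : Empty => (i.elim : A))
  refine Eq.trans ?_ h
  rw [closedVal]
  congr 1
  funext i
  exact i.elim

theorem inVariety_quot {E : Set (L.Term ℕ × L.Term ℕ)} (θ : Congruence L A)
    (h : ∀ p ∈ E, ∀ a : ℕ → A, θ.r (p.1.realize a) (p.2.realize a)) : InVariety E θ.Quot := by
  intro p hp a
  choose b hb using fun i => θ.proj_surjective (a i)
  obtain rfl : θ.projHom ∘ b = a := funext hb
  rw [HomClass.realize_term, HomClass.realize_term]
  exact θ.proj_eq_proj.2 (h p hp b)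

/-- The map from the quotient by `d` to the product of the quotients by `θ` and `θ'` is injective
since `θ ∩ θ'` lies in `d`, and surjective by `hsurj`. -/
theorem complementaryFactor_ker_factor {d θ θ' : Congruence L A} (h : ∀ a b, d.r a b → θ.r a b)
    (h' : ∀ a b, d.r a b → θ'.r a b) (hd : ∀ a b, θ.r a b → θ'.r a b → d.r a b)
    (hsurj : ∀ a b, ∃ c, θ.r c a ∧ θ'.r c b) :
    ComplementaryFactor (ker (factor d θ h)) (ker (factor d θ' h')) := by
  refine ⟨θ.Quot, θ'.Quot, _, _, factor d θ h, factor d θ' h', ⟨?_, ?_⟩, fun _ _ => Iff.rfl,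
    fun _ _ => Iff.rfl⟩
  · intro a b hab
    obtain ⟨a, rfl⟩ := d.proj_surjective a
    obtain ⟨b, rfl⟩ := d.proj_surjective b
    exact d.proj_eq_proj.2 (hd a b (θ.proj_eq_proj.1 (congrArg Prod.fst hab))
      (θ'.proj_eq_proj.1 (congrArg Prod.snd hab)))
  · rintro ⟨a, b⟩
    obtain ⟨a, rfl⟩ := θ.proj_surjective a
    obtain ⟨b, rfl⟩ := θ'.proj_surjective b
    obtain ⟨c, hc, hc'⟩ := hsurj a b
    exact ⟨d.proj c, Prod.ext (θ.proj_eq_proj.2 hc) (θ'.proj_eq_proj.2 hc')⟩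

end Congruence

end Quotients

/-! ### The generic algebra and its translation into terms -/

section GenericAlgebra

variable (L : FirstOrder.Language.{u, v}) (l : ℕ)

/-- The algebra of formal expressions over `L` extended by two binary symbols `left` and `right`.
As an `L`-algebra it is freely generated by `x`, `y`, the `z i` and all `left a b`, `right a b`. -/
inductive GenericAlg : Type (max u w)
  | x : GenericAlg
  | y : GenericAlg
  | z (i : Fin l) : GenericAlg
  | left (a b : GenericAlg) : GenericAlg
  | right (a b : GenericAlg) : GenericAlg
  | func {m : ℕ} (f : L.Functions m) (ts : Fin m → GenericAlg) : GenericAlg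

variable {L l}

namespace GenericAlg

instance : L.Structure (GenericAlg.{u, v, w} L l) where
  funMap f ts := .func f ts
  RelMap _ _ := False

/-- The homomorphism with given values at `x`, `y`, `z i`, and with values at `left a b` and
`right a b` depending on `a`, `b` and their images. -/
noncomputable def lift {A : Type*} [L.Structure A] (a b : A) (e : Fin l → A)
    (F G : GenericAlg.{u, v, w} L l → GenericAlg.{u, v, w} L l → A → A → A) :
    GenericAlg.{u, v, w} L l → A
  | .x => a
  | .y => b
  | .z i => e i
  | .left s t => F s t (lift a b e F G s) (lift a b e F G t)
  | .right s t => G s t (lift a b e F G s) (lift a b e F G t)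
  | .func f ts => Structure.funMap f fun i => lift a b e F G (ts i)

/-- `GenericAlg.lift` as a homomorphism. -/
noncomputable def liftHom {A : Type*} [L.Structure A] (a b : A) (e : Fin l → A)
    (F G : GenericAlg.{u, v, w} L l → GenericAlg.{u, v, w} L l → A → A → A) :
    GenericAlg.{u, v, w} L l →[L] A where
  toFun := lift a b e F G
  map_fun' _ _ := rfl
  map_rel' _ _ h := h.elim

/-- The congruence of the generic algebra which makes the quotient a member of the variety and
identifies `z i` with `c i`, `op a b` with `proj a b`, and, if `q` holds, `x` with `y`. -/
def cong (E : Set (L.Term ℕ × L.Term ℕ)) (c : Fin l → L.Term Empty)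
    (op proj : GenericAlg.{u, v, w} L l → GenericAlg.{u, v, w} L l → GenericAlg.{u, v, w} L l)
    (q : Prop) : Congruence L (GenericAlg.{u, v, w} L l) where
  r a b := ∀ (A : Type (max u w)) [L.Structure A] [Nonempty A], InVariety E A →
    ∀ h : GenericAlg.{u, v, w} L l →[L] A, (q → h .x = h .y) →
      (∀ i, h (.z i) = closedVal A (c i)) → (∀ s t, h (op s t) = h (proj s t)) → h a = h b
  iseqv := ⟨fun _ _ _ _ _ _ _ _ _ => rfl,
    fun hab A _ _ hA h hq hc hop => (hab A hA h hq hc hop).symm,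
    fun hab hbc A _ _ hA h hq hc hop => (hab A hA h hq hc hop).trans (hbc A hA h hq hc hop)⟩
  compatible f a b hab A _ _ hA h hq hc hop := by
    rw [h.map_fun, h.map_fun]
    exact congrArg _ (funext fun i => hab i A hA h hq hc hop)

section Cong

variable {E : Set (L.Term ℕ × L.Term ℕ)} {c : Fin l → L.Term Empty}
  {op proj : GenericAlg.{u, v, w} L l → GenericAlg.{u, v, w} L l → GenericAlg.{u, v, w} L l}
  {q : Prop}

theorem cong_equation {p : L.Term ℕ × L.Term ℕ} (hp : p ∈ E)
    (a : ℕ → GenericAlg.{u, v, w} L l) :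
    (cong E c op proj q).r (p.1.realize a) (p.2.realize a) := by
  intro A _ _ hA h _ _ _
  rw [← HomClass.realize_term, ← HomClass.realize_term]
  exact hA p hp _

theorem cong_x_y (hq : q) : (cong.{u, v, w} E c op proj q).r .x .y :=
  fun _ _ _ _ _ h _ _ => h hq

theorem cong_z (i : Fin l) :
    (cong.{u, v, w} E c op proj q).r (closedVal _ (c i)) (.z i) := by
  intro A _ _ hA h _ hc _
  rw [hc, closedVal, ← HomClass.realize_term, closedVal]
  congr 1
  funext i
  exact i.elim

theorem cong_op (s t : GenericAlg.{u, v, w} L l) :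
    (cong E c op proj q).r (op s t) (proj s t) :=
  fun _ _ _ _ _ _ _ h => h s t

end Cong

/-- The valuation interpreting `x_j` and `y_j` as `left a b` and `right a b` for the `j`-th
pair `(a, b)` of a sequence. -/
def gen (P : ℕ → GenericAlg.{u, v, w} L l × GenericAlg.{u, v, w} L l) (m : ℕ) :
    Var l m → GenericAlg.{u, v, w} L l :=
  Var.elim .x .y .z (fun j => .left (P j).1 (P j).2) (fun j => .right (P j).1 (P j).2)

/-- `a` is the value of a term in the first `m` pairs of generators. -/
def Expressible (P : ℕ → GenericAlg.{u, v, w} L l × GenericAlg.{u, v, w} L l) (m : ℕ)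
    (a : GenericAlg.{u, v, w} L l) : Prop :=
  ∃ p : L.Term (Var l m), p.realize (gen P m) = a

/-- The first `n` pairs are distinct, and each is expressible by the previous ones. -/
structure Enumeration (P : ℕ → GenericAlg.{u, v, w} L l × GenericAlg.{u, v, w} L l)
    (n : ℕ) : Prop where
  inj : ∀ i j, i < n → j < n → P i = P j → i = j
  fst : ∀ j < n, Expressible P j (P j).1
  snd : ∀ j < n, Expressible P j (P j).2

theorem Expressible.mono {P P' : ℕ → GenericAlg.{u, v, w} L l × GenericAlg.{u, v, w} L l}
    {m m' : ℕ} {a : GenericAlg.{u, v, w} L l} (h : Expressible P m a) (hm : m ≤ m')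
    (hP : ∀ j < m, P' j = P j) : Expressible P' m' a := by
  obtain ⟨p, rfl⟩ := h
  refine ⟨p.relabel (Var.elim .x .y .z (fun j => .xs (j.castLE hm)) (fun j => .ys (j.castLE hm))),
    ?_⟩
  rw [Term.realize_relabel]
  congr 1
  funext i
  cases i with
  | x => rfl
  | y => rfl
  | z i => rfl
  | xs j => simp [gen, Var.elim, hP j j.isLt]
  | ys j => simp [gen, Var.elim, hP j j.isLt]

/-- Every enumeration extends to one for which `Q` holds. -/
def Extendable (Q : (ℕ → GenericAlg.{u, v, w} L l × GenericAlg.{u, v, w} L l) → ℕ → Prop) :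
    Prop :=
  ∀ P n, Enumeration P n → ∃ P' n', Enumeration P' n' ∧ n ≤ n' ∧ (∀ j < n, P' j = P j) ∧ Q P' n'

theorem Extendable.forall_finset {ι : Type*} (f : ι → GenericAlg.{u, v, w} L l)
    (hf : ∀ i, Extendable fun P n => Expressible P n (f i)) (s : Finset ι) :
    Extendable fun P n => ∀ i ∈ s, Expressible P n (f i) := by
  classical
  induction s using Finset.induction_on with
  | empty => exact fun P n h => ⟨P, n, h, le_rfl, fun _ _ => rfl, by simp⟩
  | insert i s _ ih =>
    intro P n h
    obtain ⟨P₁, n₁, h₁, hn₁, hP₁, hs⟩ := ih P n h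
    obtain ⟨P₂, n₂, h₂, hn₂, hP₂, hi⟩ := hf i P₁ n₁ h₁
    refine ⟨P₂, n₂, h₂, hn₁.trans hn₂,
      fun j hj => (hP₂ j (hj.trans_le hn₁)).trans (hP₁ j hj), fun k hk => ?_⟩
    rcases Finset.mem_insert.1 hk with rfl | hk
    · exact hi
    · exact (hs k hk).mono hn₂ hP₂

/-- After making both components expressible, the pair is appended unless it is already listed.
Avoiding repetitions matters: a repeated pair would force two different variables to share a value.
-/
theorem Extendable.pair {s t : GenericAlg.{u, v, w} L l}
    (hs : Extendable fun P n => Expressible P n s) (ht : Extendable fun P n => Expressible P n t) :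
    Extendable fun P n => ∃ j : Fin n, P j = (s, t) := by
  intro P n h
  obtain ⟨P₁, n₁, h₁, hn₁, hP₁, hs₁⟩ := hs P n h
  obtain ⟨P₂, n₂, h₂, hn₂, hP₂, ht₂⟩ := ht P₁ n₁ h₁
  have hs₂ := hs₁.mono hn₂ hP₂
  have hP : ∀ j < n, P₂ j = P j := fun j hj => (hP₂ j (hj.trans_le hn₁)).trans (hP₁ j hj)
  by_cases hmem : ∃ j : Fin n₂, P₂ j = (s, t)
  · exact ⟨P₂, n₂, h₂, hn₁.trans hn₂, hP, hmem⟩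
  have hne : ∀ i < n₂, P₂ i ≠ (s, t) := fun i hi h => hmem ⟨⟨i, hi⟩, h⟩
  have hlt : ∀ j < n₂, Function.update P₂ n₂ (s, t) j = P₂ j := fun j hj =>
    Function.update_of_ne hj.ne _ _
  have hself : Function.update P₂ n₂ (s, t) n₂ = (s, t) := Function.update_self _ _ _
  refine ⟨Function.update P₂ n₂ (s, t), n₂ + 1, ⟨fun i j hi hj hij => ?_, fun j hj => ?_,
    fun j hj => ?_⟩, by omega, fun j hj => (hlt j (by omega)).trans (hP j hj),
    ⟨Fin.last n₂, hself⟩⟩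
  · rcases Nat.lt_succ_iff_lt_or_eq.1 hi with hi | rfl <;>
      rcases Nat.lt_succ_iff_lt_or_eq.1 hj with hj | rfl
    · rw [hlt i hi, hlt j hj] at hij
      exact h₂.inj i j hi hj hij
    · rw [hlt i hi, hself] at hij
      exact absurd hij (hne i hi)
    · rw [hlt j hj, hself] at hij
      exact absurd hij.symm (hne j hj)
    · rfl
  · rcases Nat.lt_succ_iff_lt_or_eq.1 hj with hj | rfl
    · rw [hlt j hj]
      exact (h₂.fst j hj).mono le_rfl fun i hi => hlt i (hi.trans hj)
    · rw [hself]
      exact hs₂.mono le_rfl hlt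
  · rcases Nat.lt_succ_iff_lt_or_eq.1 hj with hj | rfl
    · rw [hlt j hj]
      exact (h₂.snd j hj).mono le_rfl fun i hi => hlt i (hi.trans hj)
    · rw [hself]
      exact ht₂.mono le_rfl hlt

theorem extendable_expressible (a : GenericAlg.{u, v, w} L l) :
    Extendable fun P n => Expressible P n a := by
  induction a with
  | x => exact fun P n h => ⟨P, n, h, le_rfl, fun _ _ => rfl, .var .x, rfl⟩
  | y => exact fun P n h => ⟨P, n, h, le_rfl, fun _ _ => rfl, .var .y, rfl⟩
  | z i => exact fun P n h => ⟨P, n, h, le_rfl, fun _ _ => rfl, .var (.z i), rfl⟩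
  | left s t hs ht =>
    intro P n h
    obtain ⟨P', n', h', hn, hP, j, hj⟩ := hs.pair ht P n h
    exact ⟨P', n', h', hn, hP, .var (.xs j), by simp [gen, Var.elim, hj]⟩
  | right s t hs ht =>
    intro P n h
    obtain ⟨P', n', h', hn, hP, j, hj⟩ := hs.pair ht P n h
    exact ⟨P', n', h', hn, hP, .var (.ys j), by simp [gen, Var.elim, hj]⟩
  | func f ts ih =>
    intro P n h
    obtain ⟨P', n', h', hn, hP, hts⟩ := Extendable.forall_finset ts ih Finset.univ P n h
    choose p hp using fun i => hts i (Finset.mem_univ i)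
    exact ⟨P', n', h', hn, hP, .func f p, congrArg (GenericAlg.func f) (funext hp)⟩

theorem exists_enumeration (s : Finset (GenericAlg.{u, v, w} L l)) :
    ∃ P n, Enumeration P n ∧ ∀ a ∈ s, Expressible P n a := by
  obtain ⟨P, n, h, -, -, hs⟩ := Extendable.forall_finset id extendable_expressible s
    (fun _ => (.x, .x)) 0 ⟨by simp, by simp, by simp⟩
  exact ⟨P, n, h, hs⟩

section Identities

variable {E : Set (L.Term ℕ × L.Term ℕ)} {n : ℕ}
  {P : ℕ → GenericAlg.{u, v, w} L l × GenericAlg.{u, v, w} L l}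

/-- `cong` is an intersection of kernels of admissible homomorphisms into members of the variety. If
every valuation of the `τ`-tuple is induced by such a homomorphism through `gen`, a congruent pair
of term values is an identity after substituting `τ`. -/
theorem identity_of_cong {c : Fin l → L.Term Empty}
    {op proj : GenericAlg.{u, v, w} L l → GenericAlg.{u, v, w} L l → GenericAlg.{u, v, w} L l}
    {q : Prop} {τ : Var l n → L.Term (Var l n)}
    (hτ : ∀ (A : Type (max u w)) [L.Structure A] (a : Var l n → A),
      ∃ h : GenericAlg.{u, v, w} L l →[L] A, (q → h .x = h .y) ∧
        (∀ i, h (.z i) = closedVal A (c i)) ∧ (∀ s t, h (op s t) = h (proj s t)) ∧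
        ∀ p, (τ p).realize a = h (gen P n p))
    {p p' : L.Term (Var l n)}
    (h : (cong E c op proj q).r (p.realize (gen P n)) (p'.realize (gen P n))) :
    Identity.{u, v, w} E (p.subst τ) (p'.subst τ) := by
  intro A _ _ hA a
  obtain ⟨g, hq, hc, hop, hg⟩ := hτ A a
  have := h A hA g hq hc hop
  rw [← HomClass.realize_term, ← HomClass.realize_term] at this
  rw [Term.realize_subst, Term.realize_subst, funext hg]
  exact this

variable {s t : ∀ j : Fin n, L.Term (Var l j)}

theorem restrict_hom_gen {A : Type*} [L.Structure A] (h : GenericAlg.{u, v, w} L l →[L] A)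
    (j : Fin n) : restrict (fun p => h (gen P n p)) j = h ∘ gen P j := by
  funext i
  cases i <;> rfl

theorem hom_realize_gen {A : Type*} [L.Structure A] (h : GenericAlg.{u, v, w} L l →[L] A)
    (j : Fin n) (p : L.Term (Var l j)) :
    p.realize (restrict (fun p => h (gen P n p)) j) = h (p.realize (gen P j)) := by
  rw [restrict_hom_gen, HomClass.realize_term]

/-- The value prescribed at the pair `(s, t)` by a valuation of the pairs in an enumeration. -/
noncomputable def pairVal {A : Type*} (P : ℕ → GenericAlg.{u, v, w} L l × GenericAlg.{u, v, w} L l)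
    (a : Fin n → A) (d : A) (s t : GenericAlg.{u, v, w} L l) : A :=
  Function.extend (fun j : Fin n => P j) a (fun _ => d) (s, t)

theorem Enumeration.pairVal_eq (hP : Enumeration P n) {A : Type*} (a : Fin n → A) (d : A)
    (j : Fin n) : pairVal P a d (P j).1 (P j).2 = a j :=
  Function.Injective.extend_apply
    (fun i j hij => Fin.ext (hP.inj i j i.isLt j.isLt hij)) _ _ j

variable {zero one : Fin l → L.Term Empty} {p p' : L.Term (Var l n)}

theorem Enumeration.identity_sigma (hP : Enumeration P n)
    (hs : ∀ j, (s j).realize (gen P j) = (P j).1)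
    (h : (cong E zero .left (fun a _ => a) True).r (p.realize (gen P n)) (p'.realize (gen P n))) :
    Identity.{u, v, w} E (p.subst (sigma zero s)) (p'.subst (sigma zero s)) := by
  refine identity_of_cong (fun A _ a => ?_) h
  -- `left` acts as first projection, which reproduces the recursion for `x_j`. `right` is
  -- unconstrained, so it can take the prescribed value `y_j` at the `j`-th pair and an arbitrary
  -- default at unlisted pairs. Both `x` and `y` go to the value of `x`, as `σ` requires.
  let g := liftHom (a .x) (a .x) (fun i => closedVal A (zero i)) (fun _ _ b _ => b)
    (fun s t _ _ => pairVal P (fun j => a (.ys j)) (a .x) s t)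
  refine ⟨g, fun _ => rfl, fun _ => rfl, fun _ _ => rfl, ?_⟩
  refine sigma_rel zero s (.equality A) (b := fun p => g (gen P n p)) rfl rfl (fun _ => rfl)
    (fun j => (hP.pairVal_eq (fun j => a (.ys j)) (a .x) j).symm) fun j => ?_
  rw [hom_realize_gen, hs]
  rfl

theorem Enumeration.identity_sigmaStar (hP : Enumeration P n)
    (ht : ∀ j, (t j).realize (gen P j) = (P j).2)
    (h : (cong E one .left (fun _ b => b) False).r (p.realize (gen P n)) (p'.realize (gen P n))) :
    Identity.{u, v, w} E (p.subst (sigmaStar one t)) (p'.subst (sigmaStar one t)) := by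
  refine identity_of_cong (fun A _ a => ?_) h
  let g := liftHom (a .x) (a .y) (fun i => closedVal A (one i)) (fun _ _ _ b => b)
    (fun s t _ _ => pairVal P (fun j => a (.ys j)) (a .x) s t)
  refine ⟨g, False.elim, fun _ => rfl, fun _ _ => rfl, ?_⟩
  refine sigmaStar_rel one t (.equality A) (b := fun p => g (gen P n p)) rfl rfl (fun _ => rfl)
    (fun j => (hP.pairVal_eq (fun j => a (.ys j)) (a .x) j).symm) fun j => ?_
  rw [hom_realize_gen, ht]
  rfl

theorem Enumeration.identity_rho (hP : Enumeration P n)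
    (hs : ∀ j, (s j).realize (gen P j) = (P j).1)
    (h : (cong E zero .right (fun a _ => a) False).r (p.realize (gen P n))
      (p'.realize (gen P n))) :
    Identity.{u, v, w} E (p.subst (rho zero s)) (p'.subst (rho zero s)) := by
  refine identity_of_cong (fun A _ a => ?_) h
  -- The roles of `left` and `right` are exchanged relative to `σ`: here the `x_j` are free and the
  -- `y_j` are determined recursively.
  let g := liftHom (a .x) (a .y) (fun i => closedVal A (zero i))
    (fun s t _ _ => pairVal P (fun j => a (.xs j)) (a .x) s t) (fun _ _ b _ => b)
  refine ⟨g, False.elim, fun _ => rfl, fun _ _ => rfl, ?_⟩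
  refine rho_rel zero s (.equality A) (b := fun p => g (gen P n p)) rfl rfl (fun _ => rfl)
    (fun j => (hP.pairVal_eq (fun j => a (.xs j)) (a .x) j).symm) fun j => ?_
  rw [hom_realize_gen, hs]
  rfl

theorem Enumeration.identity_rhoStar (hP : Enumeration P n)
    (ht : ∀ j, (t j).realize (gen P j) = (P j).2)
    (h : (cong E one .right (fun _ b => b) False).r (p.realize (gen P n))
      (p'.realize (gen P n))) :
    Identity.{u, v, w} E (p.subst (rhoStar one t)) (p'.subst (rhoStar one t)) := by
  rw [rhoStar_eq_rho]
  refine identity_of_cong (fun A _ a => ?_) h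
  let g := liftHom (a .x) (a .y) (fun i => closedVal A (one i))
    (fun s t _ _ => pairVal P (fun j => a (.xs j)) (a .x) s t) (fun _ _ _ b => b)
  refine ⟨g, False.elim, fun _ => rfl, fun _ _ => rfl, ?_⟩
  refine rho_rel one t (.equality A) (b := fun p => g (gen P n p)) rfl rfl (fun _ => rfl)
    (fun j => (hP.pairVal_eq (fun j => a (.xs j)) (a .x) j).symm) fun j => ?_
  rw [hom_realize_gen, ht]
  rfl

end Identities

end GenericAlg

end GenericAlgebra

/-! ### The Left Determining Property yields the identities -/

section Necessity

variable {L : FirstOrder.Language.{u, v}} {l : ℕ} (E : Set (L.Term ℕ × L.Term ℕ))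
  (zero one : Fin l → L.Term Empty)

namespace GenericAlg

/-- For odd `i`, the congruence of the generic algebra corresponding to `sigma`, otherwise the one
corresponding to `rho`. -/
def lower (i : ℕ) : Congruence L (GenericAlg.{u, v, w} L l) :=
  if Even i then cong E zero .right (fun a _ => a) False else cong E zero .left (fun a _ => a) True

/-- For odd `i`, the congruence of the generic algebra corresponding to `sigmaStar`, otherwise the
one corresponding to `rhoStar`. -/
def upper (i : ℕ) : Congruence L (GenericAlg.{u, v, w} L l) :=
  if Even i then cong E one .right (fun _ b => b) False else cong E one .left (fun _ b => b) False

theorem lower_of_even {i : ℕ} (hi : Even i) :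
    lower.{u, v, w} E zero i = cong E zero .right (fun a _ => a) False := if_pos hi

theorem upper_of_even {i : ℕ} (hi : Even i) :
    upper.{u, v, w} E one i = cong E one .right (fun _ b => b) False := if_pos hi

theorem lower_of_odd {i : ℕ} (hi : Odd i) :
    lower.{u, v, w} E zero i = cong E zero .left (fun a _ => a) True :=
  if_neg (Nat.not_even_iff_odd.2 hi)

theorem upper_of_odd {i : ℕ} (hi : Odd i) :
    upper.{u, v, w} E one i = cong E one .left (fun _ b => b) False :=
  if_neg (Nat.not_even_iff_odd.2 hi)

/-- The levels of the generic algebra. -/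
abbrev glevel (k i : ℕ) :
    GenericAlg.{u, v, w} L l → GenericAlg.{u, v, w} L l → Prop :=
  level (lower.{u, v, w} E zero) (upper.{u, v, w} E one) k i

variable {E zero one}

/-- In the quotient by `limitCong` the property identifies the two lower joins. The odd one contains
`(x, y)` by construction, hence so does the even one, and membership in that union happens at a
finite stage. -/
theorem exists_link [L.IsAlgebraic] (h : LeftDeterminingProperty.{u, v, w} E zero one) :
    ∃ n, Link (lower.{u, v, w} E zero 0).r (glevel.{u, v, w} E zero one (n + 1) n) (n + 1)
      .x .y := by
  set Θ := lower.{u, v, w} E zero with hΘ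
  set Θ' := upper.{u, v, w} E one with hΘ'
  let d := limitCong Θ Θ'
  let J (i : ℕ) := joinCong Θ Θ' (Θ i)
  let J' (i : ℕ) := joinCong Θ Θ' (Θ' i)
  have hinf (i : ℕ) (hi : i < 2) (n : ℕ) :
      ∃ j, n ≤ j ∧ Θ (j + 1) = Θ i ∧ Θ' (j + 1) = Θ' i := by
    rcases (by omega : i = 0 ∨ i = 1) with rfl | rfl
    · have hev : Even (2 * n + 1 + 1) := ⟨n + 1, by omega⟩
      exact ⟨2 * n + 1, by omega, by simp only [hΘ, lower_of_even E zero hev,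
        lower_of_even E zero Even.zero], by simp only [hΘ', upper_of_even E one hev,
        upper_of_even E one Even.zero]⟩
    · have hodd : Odd (2 * n + 1) := ⟨n, rfl⟩
      exact ⟨2 * n, by omega, by simp only [hΘ, lower_of_odd E zero hodd,
        lower_of_odd E zero odd_one], by simp only [hΘ', upper_of_odd E one hodd,
        upper_of_odd E one odd_one]⟩
  have hiff (i : ℕ) (hi : i < 2) (a b) : d.r a b ↔ (J i).r a b ∧ (J' i).r a b :=
    limitCong_iff Θ Θ' (hinf i hi)
  have hle (i : ℕ) (hi : i < 2) (a b) (hab : d.r a b) : (J i).r a b := ((hiff i hi a b).1 hab).1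
  have hle' (i : ℕ) (hi : i < 2) (a b) (hab : d.r a b) : (J' i).r a b := ((hiff i hi a b).1 hab).2
  have hcompl (i : ℕ) (hi : i < 2) : ComplementaryFactor
      (Congruence.ker (Congruence.factor d (J i) (hle i hi)))
      (Congruence.ker (Congruence.factor d (J' i) (hle' i hi))) := by
    -- Injectivity is the fixed-point property of `limitCong`; for surjectivity, `right a b` or
    -- `left a b` is the required common solution.
    refine Congruence.complementaryFactor_ker_factor _ _
      (fun a b h₁ h₂ => (hiff i hi a b).2 ⟨h₁, h₂⟩) fun a b => ?_
    rcases (by omega : i = 0 ∨ i = 1) with rfl | rfl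
    · refine ⟨.right a b, joinCong_of_rel Θ Θ' ?_, joinCong_of_rel Θ Θ' ?_⟩
      · rw [hΘ, lower_of_even E zero Even.zero]
        exact cong_op a b
      · rw [hΘ', upper_of_even E one Even.zero]
        exact cong_op a b
    · refine ⟨.left a b, joinCong_of_rel Θ Θ' ?_, joinCong_of_rel Θ Θ' ?_⟩
      · rw [hΘ, lower_of_odd E zero odd_one]
        exact cong_op a b
      · rw [hΘ', upper_of_odd E one odd_one]
        exact cong_op a b
  have hlinks (i : ℕ) (hi : i < 2) : Links zero one
      (Congruence.ker (Congruence.factor d (J i) (hle i hi))) (fun j => d.proj (.z j))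
      (Congruence.ker (Congruence.factor d (J' i) (hle' i hi))) := by
    intro j
    rw [Congruence.closedVal_quot, Congruence.closedVal_quot, Congruence.ker_factor_proj,
      Congruence.ker_factor_proj]
    refine ⟨joinCong_of_rel Θ Θ' ?_, joinCong_of_rel Θ Θ' (Congruence.symm _ ?_)⟩
    · rcases Nat.even_or_odd i with hi | hi
      · rw [hΘ, lower_of_even E zero hi]
        exact cong_z j
      · rw [hΘ, lower_of_odd E zero hi]
        exact cong_z j
    · rcases Nat.even_or_odd i with hi | hi
      · rw [hΘ', upper_of_even E one hi]
        exact cong_z j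
      · rw [hΘ', upper_of_odd E one hi]
        exact cong_z j
  have hvar : InVariety E d.Quot := by
    refine d.inVariety_quot fun p hp a => limitCong_of_rel Θ Θ' ?_ ?_
    · rw [hΘ, lower_of_even E zero Even.zero]
      exact cong_equation hp a
    · rw [hΘ', upper_of_even E one Even.zero]
      exact cong_equation hp a
  have : Nonempty d.Quot := ⟨d.proj .x⟩
  have heq := h d.Quot hvar _ _ _ _ _ (hcompl 0 (by omega)) (hcompl 1 (by omega))
    (hlinks 1 (by omega)) (hlinks 0 (by omega))
  have hxy : (Congruence.ker (Congruence.factor d (J 1) (hle 1 (by omega)))).r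
      (d.proj .x) (d.proj .y) := by
    rw [Congruence.ker_factor_proj]
    refine joinCong_of_rel Θ Θ' ?_
    rw [hΘ, lower_of_odd E zero odd_one]
    exact cong_x_y trivial
  rw [heq, Congruence.ker_factor_proj] at hxy
  exact hxy

/-- A tree of pairs witnessing that `x` and `y` are linked, indexed by reversed words. -/
theorem exists_tree {k : ℕ} (hk : 0 < k)
    (hroot : Link (lower.{u, v, w} E zero 0).r (glevel.{u, v, w} E zero one k (2 * k - 1)) (2 * k)
      .x .y) :
    ∃ T : List ℕ → GenericAlg.{u, v, w} L l × GenericAlg.{u, v, w} L l,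
      T [] = (.x, .y) ∧
      IsChainSeq (lower.{u, v, w} E zero 0).r (fun j => T [j]) (T []).1 (T []).2 1 (2 * k) ∧
      ∀ β, IsWord (2 * k) β → 0 < β.length → β.length ≤ 2 * k →
        glevel.{u, v, w} E zero one k (2 * k - β.length) (T β).1 (T β).2 ∧
        (β.length < 2 * k →
          IsChainSeq (lower.{u, v, w} E zero β.length).r (fun j => T (j :: β)) (T β).1 (T β).2
            1 k ∧
          IsChainSeq (upper.{u, v, w} E one β.length).r (fun j => T (j :: β)) (T β).1 (T β).2
            (k + 1) (2 * k)) := by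
  -- The hypotheses stay behind the existential quantifier, so the chosen children are defined for
  -- all `m`, `p` and the tree is a plain recursion on lists.
  have hchild (m : ℕ) (p : GenericAlg.{u, v, w} L l × GenericAlg.{u, v, w} L l) :
      ∃ c : ℕ → GenericAlg.{u, v, w} L l × GenericAlg.{u, v, w} L l, m < 2 * k →
        glevel.{u, v, w} E zero one k (2 * k - m) p.1 p.2 →
        IsChainSeq (lower.{u, v, w} E zero m).r c p.1 p.2 1 k ∧
        IsChainSeq (upper.{u, v, w} E one m).r c p.1 p.2 (k + 1) (2 * k) ∧
        ∀ j, 1 ≤ j → j ≤ 2 * k →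
          glevel.{u, v, w} E zero one k (2 * k - (m + 1)) (c j).1 (c j).2 := by
    by_cases hm : m < 2 * k ∧ glevel.{u, v, w} E zero one k (2 * k - m) p.1 p.2
    swap
    · exact ⟨fun _ => p, fun h₁ h₂ => absurd ⟨h₁, h₂⟩ hm⟩
    obtain ⟨hm, hp⟩ := hm
    have hsub : 2 * k - m = 2 * k - (m + 1) + 1 := by omega
    -- A word of length `m` sits at level `2k - m`. Because `N = 2k` is even, length and level have
    -- the same parity and select the same congruences.
    have hpar : Even (2 * k - (m + 1) + 1) ↔ Even m := by
      rw [← hsub, Nat.even_sub hm.le]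
      simp
    have hlow : lower.{u, v, w} E zero (2 * k - (m + 1) + 1) = lower.{u, v, w} E zero m := by
      simp only [lower, hpar]
    have hupp : upper.{u, v, w} E one (2 * k - (m + 1) + 1) = upper.{u, v, w} E one m := by
      simp only [upper, hpar]
    rw [hsub] at hp
    obtain ⟨h₁, h₂⟩ := hp
    rw [hlow] at h₁
    rw [hupp] at h₂
    obtain ⟨k, rfl⟩ : ∃ k', k = k' + 1 := ⟨k - 1, by omega⟩
    obtain ⟨c₁, hc₁, hS₁⟩ := h₁.exists_isChainSeq 1
    obtain ⟨c₂, hc₂, hS₂⟩ := h₂.exists_isChainSeq (k + 1 + 1)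
    rw [show 1 + k = k + 1 by omega] at hc₁ hS₁
    rw [show k + 1 + 1 + k = 2 * (k + 1) by omega] at hc₂ hS₂
    refine ⟨fun j => if j ≤ k + 1 then c₁ j else c₂ j, fun _ _ =>
      ⟨hc₁.congr (by omega) fun j _ hj => if_pos hj,
        hc₂.congr (by omega) fun j hj _ => if_neg (by omega), fun j hj hj' => ?_⟩⟩
    dsimp only
    split_ifs with hjk
    · exact hS₁ j hj hjk
    · exact hS₂ j (by omega) hj'
  choose child hchild using hchild
  obtain ⟨c₀, hc₀, hS₀⟩ : ∃ c, IsChainSeq (lower.{u, v, w} E zero 0).r c .x .y 1 (2 * k) ∧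
      ∀ j, 1 ≤ j → j ≤ 2 * k →
        glevel.{u, v, w} E zero one k (2 * k - 1) (c j).1 (c j).2 := by
    obtain ⟨m, hm⟩ : ∃ m, 2 * k = m + 1 := ⟨2 * k - 1, by omega⟩
    rw [hm] at hroot ⊢
    obtain ⟨c, hc, hS⟩ := hroot.exists_isChainSeq 1
    rw [Nat.add_comm] at hc hS
    exact ⟨c, hc, hS⟩
  let T : List ℕ → GenericAlg.{u, v, w} L l × GenericAlg.{u, v, w} L l := fun β =>
    β.rec (.x, .y) fun j β p => if β = [] then c₀ j else child β.length p j
  have hT₁ (j : ℕ) : T [j] = c₀ j := rfl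
  have hT₂ (j : ℕ) (β : List ℕ) (hβ : 0 < β.length) :
      T (j :: β) = child β.length (T β) j := if_neg (List.length_pos_iff.1 hβ)
  have hlev : ∀ β, IsWord (2 * k) β → 0 < β.length → β.length ≤ 2 * k →
      glevel.{u, v, w} E zero one k (2 * k - β.length) (T β).1 (T β).2 := by
    intro β
    induction β with
    | nil => simp
    | cons j β ih =>
      intro hw _ hlen
      obtain ⟨hj, hj'⟩ := hw j List.mem_cons_self
      rw [List.length_cons] at hlen ⊢
      rcases Nat.eq_zero_or_pos β.length with hβ | hβ
      · obtain rfl := List.length_eq_zero_iff.1 hβ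
        exact hS₀ j hj hj'
      · rw [hT₂ j β hβ]
        exact (hchild _ _ (by omega)
          (ih (fun a ha => hw a (List.mem_cons_of_mem _ ha)) hβ (by omega))).2.2 j hj hj'
  refine ⟨T, rfl, hc₀, fun β hw hpos hlen => ⟨hlev β hw hpos hlen, fun hlt => ?_⟩⟩
  simp only [hT₂ _ β hpos]
  obtain ⟨h₁, h₂, -⟩ := hchild β.length (T β) hlt (hlev β hw hpos hlen)
  exact ⟨h₁, h₂⟩

theorem finite_isWord (N : ℕ) : {α : List ℕ | IsWord N α ∧ α.length ≤ N}.Finite := by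
  refine ((List.finite_length_le (Fin (N + 1)) N).image (List.map Fin.val)).subset ?_
  rintro α ⟨hα, hlen⟩
  lift α to List (Fin (N + 1)) using fun a ha => Nat.lt_succ_of_le (hα a ha).2
  exact ⟨α, by simpa using hlen, rfl⟩

/-- Appending a letter to `α` is prepending it to the reversed word, so the children in the tree
match the words `α ++ [j]`, and `hτ` converts each link of the chain separately. -/
theorem chain_of_isChainSeq {n k p q : ℕ} (hp : 1 ≤ p) (hpq : p ≤ q) (hq : q ≤ 2 * k)
    {θ : Congruence L (GenericAlg.{u, v, w} L l)}
    {P : ℕ → GenericAlg.{u, v, w} L l × GenericAlg.{u, v, w} L l}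
    {τ : Var l n → L.Term (Var l n)}
    (hτ : ∀ p p' : L.Term (Var l n), θ.r (p.realize (gen P n)) (p'.realize (gen P n)) →
      Identity.{u, v, w} E (p.subst τ) (p'.subst τ))
    {LL RR : List ℕ → L.Term (Var l n)}
    {T : List ℕ → GenericAlg.{u, v, w} L l × GenericAlg.{u, v, w} L l}
    (hLL : ∀ α, IsWord (2 * k) α → α.length ≤ 2 * k →
      (LL α).realize (gen P n) = (T α.reverse).1)
    (hRR : ∀ α, IsWord (2 * k) α → α.length ≤ 2 * k →
      (RR α).realize (gen P n) = (T α.reverse).2)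
    {α : List ℕ} (hα : IsWord (2 * k) α) (hlen : α.length < 2 * k)
    (h : IsChainSeq θ.r (fun j => T (j :: α.reverse)) (T α.reverse).1 (T α.reverse).2 p q) :
    Chain.{u, v, w} E LL RR τ α p q := by
  have hL (j : ℕ) (h₁ : p ≤ j) (h₂ : j ≤ q) :
      (LL (α ++ [j])).realize (gen P n) = (T (j :: α.reverse)).1 := by
    rw [hLL _ (hα.append (by omega) (by omega)) (by simp; omega)]
    simp
  have hR (j : ℕ) (h₁ : p ≤ j) (h₂ : j ≤ q) :
      (RR (α ++ [j])).realize (gen P n) = (T (j :: α.reverse)).2 := by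
    rw [hRR _ (hα.append (by omega) (by omega)) (by simp; omega)]
    simp
  refine ⟨hτ _ _ ?_, fun j h₁ h₂ => hτ _ _ ?_, hτ _ _ ?_⟩
  · rw [hLL α hα hlen.le, hL p le_rfl hpq]
    exact h.first
  · rw [hR j h₁ h₂.le, hL (j + 1) (by omega) h₂]
    exact h.step j h₁ h₂
  · rw [hRR α hα hlen.le, hR q hpq le_rfl]
    exact h.last

end GenericAlg

open GenericAlg

variable {E zero one}

theorem LeftDeterminingProperty.exists_malcevSystem [L.IsAlgebraic]
    (h : LeftDeterminingProperty.{u, v, w} E zero one) :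
    ∃ k n : ℕ, 0 < k ∧ ∃ (s t : ∀ j : Fin n, L.Term (Var l j))
      (LL RR : List ℕ → L.Term (Var l n)), MalcevSystem.{u, v, w} E zero one k s t LL RR := by
  classical
  obtain ⟨m, hm⟩ := exists_link h
  obtain ⟨k, rfl⟩ : ∃ k, k = m + 1 := ⟨_, rfl⟩
  set k := m + 1 with hk
  -- Padding by reflexive steps brings the link to width `2k` over level `2k - 1`, so one number `k`
  -- governs both the branching and the depth of the tree.
  have hroot : Link (lower.{u, v, w} E zero 0).r (glevel.{u, v, w} E zero one k (2 * k - 1))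
      (2 * k) .x .y :=
    link_level_mono _ _ _ le_rfl (by omega) (by omega) (by omega) hm
  obtain ⟨T, hT, hT₀, hTβ⟩ := exists_tree (by omega) hroot
  obtain ⟨P, n, hP, hexp⟩ := exists_enumeration
    ((finite_isWord (2 * k)).toFinset.image (fun α : List ℕ => (T α.reverse).1) ∪
      (finite_isWord (2 * k)).toFinset.image (fun α : List ℕ => (T α.reverse).2))
  have hexp₁ (α : List ℕ) (hα : IsWord (2 * k) α) (hlen : α.length ≤ 2 * k) :
      Expressible P n (T α.reverse).1 := by
    refine hexp _ (Finset.mem_union_left _ (Finset.mem_image_of_mem (fun α : List ℕ => (T α.reverse).1) ?_))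
    exact (finite_isWord (2 * k)).mem_toFinset.2 ⟨hα, hlen⟩
  have hexp₂ (α : List ℕ) (hα : IsWord (2 * k) α) (hlen : α.length ≤ 2 * k) :
      Expressible P n (T α.reverse).2 := by
    refine hexp _ (Finset.mem_union_right _ (Finset.mem_image_of_mem (fun α : List ℕ => (T α.reverse).2) ?_))
    exact (finite_isWord (2 * k)).mem_toFinset.2 ⟨hα, hlen⟩
  -- The identities for `L_ε` and `R_ε` involve no substitution, so these two terms are fixed to be
  -- the variables themselves. Lists that are not relevant words get a default term.
  have hLL (α : List ℕ) : ∃ p : L.Term (Var l n), (α = [] → p = .var .x) ∧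
      (IsWord (2 * k) α → α.length ≤ 2 * k → p.realize (gen P n) = (T α.reverse).1) := by
    by_cases hα : α = []
    · subst hα
      exact ⟨.var .x, fun _ => rfl, fun _ _ => by simp [hT, gen, Var.elim]⟩
    by_cases hw : IsWord (2 * k) α ∧ α.length ≤ 2 * k
    · obtain ⟨p, hp⟩ := hexp₁ α hw.1 hw.2
      exact ⟨p, fun h => absurd h hα, fun _ _ => hp⟩
    · exact ⟨.var .x, fun _ => rfl, fun h₁ h₂ => absurd ⟨h₁, h₂⟩ hw⟩
  have hRR (α : List ℕ) : ∃ p : L.Term (Var l n), (α = [] → p = .var .y) ∧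
      (IsWord (2 * k) α → α.length ≤ 2 * k → p.realize (gen P n) = (T α.reverse).2) := by
    by_cases hα : α = []
    · subst hα
      exact ⟨.var .y, fun _ => rfl, fun _ _ => by simp [hT, gen, Var.elim]⟩
    by_cases hw : IsWord (2 * k) α ∧ α.length ≤ 2 * k
    · obtain ⟨p, hp⟩ := hexp₂ α hw.1 hw.2
      exact ⟨p, fun h => absurd h hα, fun _ _ => hp⟩
    · exact ⟨.var .y, fun _ => rfl, fun h₁ h₂ => absurd ⟨h₁, h₂⟩ hw⟩
  choose LL hLx hLL using hLL
  choose RR hRy hRR using hRR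
  choose s hs using fun j : Fin n => hP.fst j j.isLt
  choose t ht using fun j : Fin n => hP.snd j j.isLt
  have hrho {i : ℕ} (hi : Even i) (p p' : L.Term (Var l n)) :
      (lower.{u, v, w} E zero i).r (p.realize (gen P n)) (p'.realize (gen P n)) →
        Identity.{u, v, w} E (p.subst (rho zero s)) (p'.subst (rho zero s)) := by
    rw [lower_of_even E zero hi]
    exact hP.identity_rho hs
  have hrhoStar {i : ℕ} (hi : Even i) (p p' : L.Term (Var l n)) :
      (upper.{u, v, w} E one i).r (p.realize (gen P n)) (p'.realize (gen P n)) →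
        Identity.{u, v, w} E (p.subst (rhoStar one t)) (p'.subst (rhoStar one t)) := by
    rw [upper_of_even E one hi]
    exact hP.identity_rhoStar ht
  have hsigma {i : ℕ} (hi : Odd i) (p p' : L.Term (Var l n)) :
      (lower.{u, v, w} E zero i).r (p.realize (gen P n)) (p'.realize (gen P n)) →
        Identity.{u, v, w} E (p.subst (sigma zero s)) (p'.subst (sigma zero s)) := by
    rw [lower_of_odd E zero hi]
    exact hP.identity_sigma hs
  have hsigmaStar {i : ℕ} (hi : Odd i) (p p' : L.Term (Var l n)) :
      (upper.{u, v, w} E one i).r (p.realize (gen P n)) (p'.realize (gen P n)) →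
        Identity.{u, v, w} E (p.subst (sigmaStar one t)) (p'.subst (sigmaStar one t)) := by
    rw [upper_of_odd E one hi]
    exact hP.identity_sigmaStar ht
  have hrev {α : List ℕ} (hα : IsWord (2 * k) α) : IsWord (2 * k) α.reverse :=
    fun a ha => hα a (List.mem_reverse.1 ha)
  have htop (α : List ℕ) (hα : IsWord (2 * k) α) (hlen : α.length = 2 * k) :
      glevel.{u, v, w} E zero one k 0 (T α.reverse).1 (T α.reverse).2 := by
    simpa [hlen] using (hTβ α.reverse (hrev hα) (by simp; omega) (by simp; omega)).1
  have hchains (α : List ℕ) (hα : IsWord (2 * k) α) (hpos : 0 < α.length)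
      (hlen : α.length < 2 * k) :=
    (hTβ α.reverse (hrev hα) (by simpa using hpos) (by simpa using hlen.le)).2 (by simpa using hlen)
  refine ⟨k, n, by omega, s, t, LL, RR, ?_⟩
  refine
    { top_rho := fun α hα hlen => hrho Even.zero _ _ ?_
      top_rhoStar := fun α hα hlen => hrhoStar Even.zero _ _ ?_
      empty_left := ?_
      empty_right := ?_
      empty_rho := chain_of_isChainSeq le_rfl (by omega) le_rfl (hrho Even.zero) hLL hRR
        (by simp [IsWord]) (by simp; omega) hT₀
      even_rho := fun α hα hpos hlen hev => chain_of_isChainSeq le_rfl (by omega) (by omega)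
        (hrho (by simpa using hev)) hLL hRR hα hlen (hchains α hα hpos hlen).1
      even_rhoStar := fun α hα hpos hlen hev => chain_of_isChainSeq (by omega) (by omega) le_rfl
        (hrhoStar (by simpa using hev)) hLL hRR hα hlen (hchains α hα hpos hlen).2
      odd_sigma := fun α hα hpos hlen hodd => chain_of_isChainSeq le_rfl (by omega) (by omega)
        (hsigma (by simpa using hodd)) hLL hRR hα hlen (hchains α hα hpos hlen).1
      odd_sigmaStar := fun α hα hpos hlen hodd => chain_of_isChainSeq (by omega) (by omega) le_rfl
        (hsigmaStar (by simpa using hodd)) hLL hRR hα hlen (hchains α hα hpos hlen).2 }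
  · rw [hLL α hα hlen.le, hRR α hα hlen.le]
    exact (htop α hα hlen).1
  · rw [hLL α hα hlen.le, hRR α hα hlen.le]
    exact (htop α hα hlen).2
  · rw [hLx [] rfl]
    exact fun _ _ _ _ _ => rfl
  · rw [hRy [] rfl]
    exact fun _ _ _ _ _ => rfl

end Necessity

end MalcevLDP

theorem theorem2 (L : FirstOrder.Language.{u, v}) [L.IsAlgebraic]
    (E : Set (L.Term ℕ × L.Term ℕ)) (l : ℕ) (zero one : Fin l → L.Term Empty)
    (h01 : MalcevLDP.HasZeroOne.{u, v, w} E zero one) :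
    MalcevLDP.LeftDeterminingProperty.{u, v, w} E zero one ↔
      ∃ k n : ℕ, 0 < k ∧
        ∃ (s t : ∀ j : Fin n, L.Term (MalcevLDP.Var l j))
          (LL RR : List ℕ → L.Term (MalcevLDP.Var l n)),
          MalcevLDP.MalcevSystem.{u, v, w} E zero one k s t LL RR := by
  refine ⟨fun h => h.exists_malcevSystem, ?_⟩
  rintro ⟨k, n, hk, s, t, LL, RR, h⟩ A _ _ hA e φ φ' θ θ' hφ hθ lθ lφ
  -- The hypotheses are symmetric in the two pairs of congruences, so one inclusion, used twice,
  -- gives equality.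
  exact MalcevLDP.Congruence.ext_r fun a b =>
    ⟨h.rel_of_rel hk hA hφ hθ lθ lφ, h.rel_of_rel hk hA hθ hφ lφ lθ⟩
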